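/- Let $F$ be a number field with ring of integers $O_F$ and discriminant $\Delta$, and let $w$ be the number of roots of unity in $F$. An Arakelov divisor is a formal finite sum $D=\sum_P x_P P+\sum_\sigma x_\sigma\sigma$ over the nonzero primes $P$ of $O_F$ and the infinite places $\sigma$ of $F$, with $x_P\in\mathbf Z$ and $x_\sigma\in\mathbf R$. Put $N(D)=e^{\deg D}$ with $\deg D=\sum_P x_P\log N(P)+\sum_\sigma x_\sigma$, let $I=\prod_P P^{-x_P}$ be the associated fractional ideal, and for $f\in F$ put $\|f\|_D^2=\sum_\sigma|\sigma(f)|^2\|1\|_\sigma^2$, where $\|1\|_\sigma^2=e^{-2x_\sigma}$ for real $\sigma$ and $\|1\|_\sigma^2=2e^{-x_\sigma}$ for complex $\sigma$. The principal divisor of $f\in F^*$ is $(f)=\sum_P\mathrm{ord}_P(f)P-\sum_{\sigma\ \mathrm{real}}\log|\sigma(f)|\,\sigma-\sum_{\sigma\ \mathrm{complex}}2\log|\sigma(f)|\,\sigma$, and $\mathrm{Pic}(F)$ is the quotient of the group $\mathrm{Div}(F)$ of Arakelov divisors by the subgroup of principal divisors. Put $h^0(D)=\log\sum_{f\in I}e^{-\pi\|f\|_D^2}$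 and $h^1(D)=h^0(\kappa-D)$, where $\kappa$ is the divisor whose ideal is the inverse different of $F$ and whose infinite components are $0$; both depend only on the class $[D]$ of $D$ in $\mathrm{Pic}(F)$. Let $dD$ be the measure on $\mathrm{Div}(F)$ that is the product of the counting measure on the finite parts and Lebesgue measure $\prod_\sigma dx_\sigma$ on the infinite parts, and let $d[D]$ be the quotient measure on $\mathrm{Pic}(F)$, the subgroup of principal divisors carrying the counting measure. Let $e(D)=e^{-\pi\|1\|_D^2}$ if $O_F\subset I$ and $e(D)=0$ otherwise, and let $Z_F$ be the meromorphic continuation to $\mathbf C$ of $\int_{\mathrm{Div}(F)}e(D)N(D)^{-s}\,dD$, an integral that converges absolutely for $\mathrm{Re}(s)>1$; it is holomorphic outside $\{0,1\}$. Then the integral $$\zeta_F(s,t)=\int_{\mathrm{Pic}(F)}e^{s\,h^0(D)+t\,h^1(D)}\,d[D]$$ converges absolutely for all complex $s,t$ with $\mathrm{Re}(s)<0$ and $\mathrm{Re}(t)<0$, and $\zeta_F$ can be continued to a meromorphic function on $\mathbf C^2$. For $s\ne 0,1$ this continuation is holomorphic at the point $(s,1-s)$ of the line $s+t=1$, and its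 value there is $$\zeta_F(s,1-s)=w\,\sqrt{|\Delta|}^{\;s}\,Z_F(s).$$ -/

import Mathlib

open NumberField MeasureTheory IsDedekindDomain
open scoped nonZeroDivisors

noncomputable section

namespace Arakelov

/-- The finite parts `∑ x_P P` of Arakelov divisors form a countable discrete group. -/
instance finitePartMeasurableSpace (F : Type*) [Field F] [NumberField F] :
    MeasurableSpace (HeightOneSpectrum (𝓞 F) →₀ ℤ) := ⊤

/-- Arakelov divisors `D = ∑ x_P P + ∑ x_σ σ`: integers `x_P = D.1 P`, almost all zero, at the
nonzero primes of `𝓞 F`, and real numbers `x_σ = D.2 σ` at the infinite places. -/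
abbrev Divisor (F : Type*) [Field F] [NumberField F] : Type _ :=
  (HeightOneSpectrum (𝓞 F) →₀ ℤ) × (InfinitePlace F → ℝ)

variable {F : Type*} [Field F] [NumberField F]

/-- The finite divisor `∑ ord_P(I) P` of a fractional ideal `I`. -/
def idealDivisor (I : FractionalIdeal (𝓞 F)⁰ F) : HeightOneSpectrum (𝓞 F) →₀ ℤ :=
  Finsupp.ofSupportFinite (fun v ↦ FractionalIdeal.count F v I)
    (FractionalIdeal.finite_factors I)

/-- The degree `deg D = ∑ log N(P) x_P + ∑ x_σ`. -/
def degree (D : Divisor F) : ℝ :=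
  (D.1.sum fun P x ↦ Real.log (Ideal.absNorm P.asIdeal) * x) + ∑ σ, D.2 σ

/-- The norm `N(D) = exp (deg D)`. -/
def norm (D : Divisor F) : ℝ := Real.exp (degree D)

/-- The fractional ideal `I = ∏ P ^ (-x_P)` associated with `D`. -/
def ideal (D : Divisor F) : FractionalIdeal (𝓞 F)⁰ F :=
  D.1.prod fun P x ↦ (P.asIdeal : FractionalIdeal (𝓞 F)⁰ F) ^ (-x)

/-- The squared length `‖f‖_D² = ∑_σ |σ(f)|² ‖1‖_σ²`, where `‖1‖_σ² = exp (-2 x_σ)` at the real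
places (`mult = 1`) and `‖1‖_σ² = 2 exp (-x_σ)` at the complex places (`mult = 2`). -/
def normSq (D : Divisor F) (f : F) : ℝ :=
  ∑ σ : InfinitePlace F, σ f ^ 2 * (σ.mult * Real.exp (-2 * D.2 σ / σ.mult))

/-- `k⁰(D) = ∑_{f ∈ I} exp (-π ‖f‖_D²)`. -/
def k0 (D : Divisor F) : ℝ :=
  ∑' f : {f : F // f ∈ ideal D}, Real.exp (-Real.pi * normSq D f)

/-- `h⁰(D) = log k⁰(D)`. -/
def h0 (D : Divisor F) : ℝ := Real.log (k0 D)

open Classical in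
/-- The effectivity: `e(D) = exp (-π ‖1‖_D²)` if `𝓞 F ⊆ I`, and `e(D) = 0` otherwise. -/
def effectivity (D : Divisor F) : ℝ :=
  if 1 ≤ ideal D then Real.exp (-Real.pi * normSq D 1) else 0

lemma idealDivisor_mul {I J : FractionalIdeal (𝓞 F)⁰ F} (hI : I ≠ 0) (hJ : J ≠ 0) :
    idealDivisor (I * J) = idealDivisor I + idealDivisor J := by
  ext v
  exact FractionalIdeal.count_mul F v hI hJ

lemma span_ne_zero (f : Fˣ) : FractionalIdeal.spanSingleton (𝓞 F)⁰ (f : F) ≠ 0 :=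
  FractionalIdeal.spanSingleton_ne_zero_iff.mpr f.ne_zero

variable (F) in
/-- The principal divisor `(f)`: `x_P = ord_P f`, and `x_σ = -log |σ(f)|` or `-2 log |σ(f)|`
according to whether `σ` is real (`mult = 1`) or complex (`mult = 2`). -/
def principal : Additive Fˣ →+ Divisor F where
  toFun f := (idealDivisor (FractionalIdeal.spanSingleton (𝓞 F)⁰ (f.toMul : F)),
    fun σ ↦ -(σ.mult * Real.log (σ (f.toMul : F))))
  map_zero' := by
    refine Prod.ext (Finsupp.ext fun v ↦ ?_) (funext fun σ ↦ ?_)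
    · simpa [idealDivisor, Finsupp.ofSupportFinite] using FractionalIdeal.count_one F v
    · simp
  map_add' f g := by
    refine Prod.ext ?_ (funext fun σ ↦ ?_)
    · simp only [toMul_add, Units.val_mul, ← FractionalIdeal.spanSingleton_mul_spanSingleton]
      exact idealDivisor_mul (span_ne_zero _) (span_ne_zero _)
    · have hf : σ (f.toMul : F) ≠ 0 := by simp
      have hg : σ (g.toMul : F) ≠ 0 := by simp
      simp only [toMul_add, Units.val_mul, map_mul, Real.log_mul hf hg, Prod.snd_add, Pi.add_apply]
      ring

variable (F) in
/-- The Arakelov class group `Pic(F) = Div(F) / {(f) : f ∈ Fˣ}`. -/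
abbrev Pic : Type _ := Divisor F ⧸ (principal F).range

lemma ideal_idealDivisor {I : FractionalIdeal (𝓞 F)⁰ F} (hI : I ≠ 0) :
    ((idealDivisor I).prod fun P x ↦ (P.asIdeal : FractionalIdeal (𝓞 F)⁰ F) ^ (-x)) = I⁻¹ := by
  have h := FractionalIdeal.finprod_heightOneSpectrum_factorization' (K := F) hI
  conv_rhs => rw [← h]
  rw [finprod_eq_finsetProd_of_mulSupport_subset (s := (idealDivisor I).support),
    ← Finset.prod_inv_distrib]
  · simp only [Finsupp.prod, zpow_neg]
    rfl
  · intro v hv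
    rw [Finset.mem_coe, Finsupp.mem_support_iff]
    intro h0
    apply hv
    change FractionalIdeal.count F v I = 0 at h0
    simp only [h0, zpow_zero]

lemma ideal_add (D E : Divisor F) : ideal (D + E) = ideal D * ideal E := by
  classical
  refine Finsupp.prod_add_index' (by simp) fun v a b ↦ ?_
  rw [neg_add, zpow_add₀ (FractionalIdeal.coeIdeal_ne_zero.mpr v.ne_bot)]

lemma mem_ideal_add_principal (D : Divisor F) (g : Additive Fˣ) (f : F) :
    f ∈ ideal (D + principal F g) ↔ f * (g.toMul : F) ∈ ideal D := by
  have hg : (g.toMul : F) ≠ 0 := g.toMul.ne_zero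
  have h : ideal (principal F g) = FractionalIdeal.spanSingleton (𝓞 F)⁰ (g.toMul : F)⁻¹ := by
    rw [← FractionalIdeal.spanSingleton_inv]
    exact ideal_idealDivisor (span_ne_zero _)
  rw [ideal_add, h, mul_comm, FractionalIdeal.mem_singleton_mul]
  constructor
  · rintro ⟨y, hy, rfl⟩
    rwa [mul_comm _ y, mul_assoc, inv_mul_cancel₀ hg, mul_one]
  · intro hf
    exact ⟨_, hf, by field_simp⟩

lemma normSq_add_principal (D : Divisor F) (g : Additive Fˣ) (f : F) :
    normSq (D + principal F g) f = normSq D (f * (g.toMul : F)) := by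
  refine Finset.sum_congr rfl fun σ _ ↦ ?_
  have hg : 0 < σ (g.toMul : F) := by simp [InfinitePlace.pos_iff]
  have hm : (σ.mult : ℝ) ≠ 0 := InfinitePlace.mult_coe_ne_zero
  have h : -2 * (D + principal F g).2 σ / σ.mult
      = -2 * D.2 σ / σ.mult + (Real.log (σ (g.toMul : F)) + Real.log (σ (g.toMul : F))) := by
    simp only [principal, Prod.snd_add, Pi.add_apply, AddMonoidHom.coe_mk, ZeroHom.coe_mk]
    field_simp
    ring
  rw [h, Real.exp_add, Real.exp_add, Real.exp_log hg, map_mul]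
  ring

/-- `k⁰` depends only on the class of the divisor. -/
lemma k0_add_principal (D : Divisor F) (g : Additive Fˣ) : k0 (D + principal F g) = k0 D := by
  have hg : (g.toMul : F) ≠ 0 := g.toMul.ne_zero
  let e : {f : F // f ∈ ideal (D + principal F g)} ≃ {f : F // f ∈ ideal D} :=
    (Equiv.mulRight₀ _ hg).subtypeEquiv fun f ↦ mem_ideal_add_principal D g f
  rw [k0, k0, ← e.tsum_eq]
  exact tsum_congr fun f ↦ by rw [normSq_add_principal]; rfl

/-- The function `h⁰` on `Pic(F)`. -/
def picH0 : Pic F → ℝ :=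
  Quotient.lift h0 fun D E hDE ↦ by
    obtain ⟨g, hg⟩ := QuotientAddGroup.leftRel_apply.mp hDE
    rw [h0, h0, show E = D + principal F g by rw [hg]; abel, k0_add_principal]

variable (F) in
/-- The canonical divisor `κ`: its ideal is the inverse of the different of `F`, and its infinite
components are zero. -/
def canonicalDivisor : Divisor F :=
  (idealDivisor (differentIdeal ℤ (𝓞 F) : FractionalIdeal (𝓞 F)⁰ F), 0)

/-- `h¹(D) = h⁰(κ - D)` on `Pic(F)`. -/
def picH1 (c : Pic F) : ℝ := picH0 ((canonicalDivisor F : Pic F) - c)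

variable (F) in
/-- The measure `dD` on `Div(F)`: counting measure on the finite parts times Lebesgue measure
`∏ dx_σ` on the infinite parts. -/
def divMeasure : Measure (Divisor F) := Measure.count.prod volume

variable (F) in
/-- The measure `d[D]` on `Pic(F)`, the quotient of `dD` by the counting measure on the discrete
group of principal divisors: it is the smallest measure on `Pic(F)` that dominates the image of
`dD` restricted to `S`, for each measurable set `S` of divisors that meets each class at most once.
When `S` is a measurable set of representatives of all classes, it is equal to that image. -/
def picMeasure : Measure (Pic F) :=
  ⨆ (S : Set (Divisor F)) (_ : MeasurableSet S)
    (_ : S.InjOn (QuotientAddGroup.mk : Divisor F → Pic F)),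
      ((divMeasure F).restrict S).map QuotientAddGroup.mk

/-- The integrand `exp (s h⁰(D) + t h¹(D))` on `Pic(F)`. -/
def twoVarIntegrand (s t : ℂ) (c : Pic F) : ℂ :=
  Complex.exp (s * picH0 c + t * picH1 c)

variable (F) in
/-- `ζ_F(s,t) = ∫_{Pic(F)} exp (s h⁰(D) + t h¹(D)) d[D]`, where this converges. -/
def twoVarZeta (s t : ℂ) : ℂ := ∫ c : Pic F, twoVarIntegrand s t c ∂picMeasure F

/-- The integrand `e(D) N(D)^(-s)` on `Div(F)`. -/
def zetaIntegrand (s : ℂ) (D : Divisor F) : ℂ :=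
  (effectivity D : ℂ) * (norm D : ℂ) ^ (-s)

variable (F) in
/-- `Z_F(s) = ∫_{Div(F)} e(D) N(D)^(-s) dD`, where this converges. -/
def zeta (s : ℂ) : ℂ := ∫ D : Divisor F, zetaIntegrand s D ∂divMeasure F

/-- `Φ` is a meromorphic function on the whole space `E`: near each point it is a quotient `g / h`
of two holomorphic functions, where `h` does not vanish identically near that point. -/
def IsMeromorphic {E : Type*} [NormedAddCommGroup E] [NormedSpace ℂ E] (Φ : E → ℂ) : Prop :=
  ∀ p : E, ∃ g h : E → ℂ, AnalyticAt ℂ g p ∧ AnalyticAt ℂ h p ∧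
    (∃ᶠ q in nhds p, h q ≠ 0) ∧ ∀ᶠ q in nhds p, h q ≠ 0 → Φ q = g q / h q

end Arakelov

end

/-!
Let `a = h⁰` and `b = h¹ - h⁰` on `Pic(F)`, so that the integrand of the two-variable zeta function
is `exp (s a + t (a + b))`. Poisson summation over the lattice of an Arakelov divisor gives the
**Riemann–Roch theorem** `k0_eq_mul_k0_canonicalDivisor_sub`, which says that `b = log √|Δ| - deg`.
The reflection `c ↦ κ - c` preserves the measure, takes `a` to `a + b` and `b` to `-b`.

**Unfolding.** The terms of `k⁰(D) - 1`, indexed by the nonzero `f ∈ I`, are the effectivities of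
the divisors `D + (f)`, and each divisor linearly equivalent to `D` occurs `w` times. Hence the
integral of `e(D) g([D])` over `Div(F)`, multiplied by `w`, is the integral of `(exp a - 1) g` over
`Pic(F)` (`lintegral_effectivity_mul`), and `w √|Δ| ^ s Z_F(s)` is the integral of
`(exp a - 1) exp (s b)` for `Re s > 1`.

**Finiteness.** That integral converges, because the number of ideals of norm at most `n` is
`O(n)`. The finiteness of the volume and the boundedness of `h⁰` are consequences. By
Riemann–Roch, `exp a - 1 ≥ 1` on `-2 < b < -1`, so that this part of `Pic(F)` has finite
volume. By translation invariance the image of the measure under `b` is then a multiple `V`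
of Lebesgue measure (`exists_map_defect_eq`). On `b ≥ 0` the function `a` is bounded, since
`k⁰ - 1` is at most a constant times its mean over a small box of larger divisors
(`exists_picH0_le`).

**Continuation.** Write `G(u, t)` for the integral of `(exp (u a) - 1) exp (t b)` over `{b > 0}`.
There `a` is bounded and decays faster than every exponential of `b`, so that `G` is entire
(`analyticAt_integral_exp_sub_one`). Adding the integral of `exp (t b)`, which is `-V / t` for
`Re t < 0`, and folding `{b < 0}` onto `{b > 0}` by the reflection, one obtains
`ζ_F(s, t) = G(s + t, t) + G(s + t, s) - V / s - V / t`. For `Re s > 1` the same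
splitting of the integral of `(exp a - 1) exp (s b)` gives
`G(1, s) + G(1, 1 - s) - V / s - V / (1 - s)`, which is the value of this formula at `t = 1 - s`.
Both continuations are read off from `exists_twoVariable_continuation`.
-/

namespace Arakelov

/-! ### Gaussian sums and Poisson summation -/

section GaussianSums

variable {ι : Type*}

/-- The integer vector `m` as a real vector. -/
abbrev intVec (m : ι → ℤ) : ι → ℝ := fun i ↦ (m i : ℝ)

/-- The half-open unit cube with lower corner `m`. -/
def unitCube (m : ι → ℤ) : Set (ι → ℝ) := {x | ∀ i, x i ∈ Set.Ioc (m i : ℝ) (m i + 1)}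

lemma mem_unitCube_iff {m : ι → ℤ} {x : ι → ℝ} : x ∈ unitCube m ↔ ∀ i, m i = ⌈x i⌉ - 1 := by
  refine forall_congr' fun i ↦ ?_
  rw [Set.mem_Ioc, eq_sub_iff_add_eq, eq_comm, Int.ceil_eq_iff]
  push_cast
  simp

lemma pairwise_disjoint_unitCube : Pairwise (Function.onFun Disjoint (unitCube (ι := ι))) := by
  intro m n hmn
  refine Set.disjoint_left.mpr fun x hm hn ↦ hmn (funext fun i ↦ ?_)
  rw [mem_unitCube_iff.mp hm i, mem_unitCube_iff.mp hn i]

lemma iUnion_unitCube : ⋃ m, unitCube (ι := ι) m = Set.univ :=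
  Set.eq_univ_of_forall fun x ↦ Set.mem_iUnion.mpr
    ⟨fun i ↦ ⌈x i⌉ - 1, mem_unitCube_iff.mpr fun _ ↦ rfl⟩

/-- The projection `ℝ^ι → (ℝ/ℤ)^ι`. -/
abbrev toTorus (x : ι → ℝ) : UnitAddTorus ι := fun i ↦ (x i : UnitAddCircle)

lemma isOpenQuotientMap_toTorus : IsOpenQuotientMap (toTorus (ι := ι)) :=
  IsOpenQuotientMap.piMap fun _ ↦ QuotientAddGroup.isOpenQuotientMap_mk

variable [Fintype ι]

lemma measurableSet_unitCube (m : ι → ℤ) : MeasurableSet (unitCube m) := by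
  simp only [unitCube, Set.ofPred_forall]
  exact .iInter fun i ↦ measurableSet_Ioc.preimage (measurable_pi_apply i)

lemma setIntegral_unitCube {E : Type*} [NormedAddCommGroup E] [NormedSpace ℝ E] (g : (ι → ℝ) → E)
    (m : ι → ℤ) : ∫ x in unitCube m, g x = ∫ x in unitCube 0, g (x + intVec m) := by
  have h := (measurePreserving_add_right (volume : Measure (ι → ℝ)) (intVec m))
  rw [← h.setIntegral_preimage_emb (measurableEmbedding_addRight _)]
  congr 2
  ext x
  refine forall_congr' fun i ↦ ?_
  simp only [Pi.add_apply, Pi.zero_apply, Set.mem_Ioc, Int.cast_zero, zero_add]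
  constructor <;> rintro ⟨h1, h2⟩ <;> constructor <;> linarith

/-- Integration over `ℝ^ι` by summation over the integer translates of the unit cube. -/
lemma integral_eq_integral_tsum {g : (ι → ℝ) → ℂ} (hg : Integrable g) :
    ∫ x, g x = ∫ x in unitCube 0, ∑' m : ι → ℤ, g (x + intVec m) := by
  have h1 : HasSum (fun m : ι → ℤ ↦ ∫ x in unitCube 0, g (x + intVec m)) (∫ x, g x) := by
    have := hasSum_integral_iUnion (μ := volume) (f := g) measurableSet_unitCube
      pairwise_disjoint_unitCube (by rw [iUnion_unitCube]; exact hg.integrableOn)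
    simpa [iUnion_unitCube, setIntegral_unitCube g] using this
  have h2 : HasSum (fun m : ι → ℤ ↦ ∫ x in unitCube 0, ‖g (x + intVec m)‖) (∫ x, ‖g x‖) := by
    have := hasSum_integral_iUnion (μ := volume) (f := fun x ↦ ‖g x‖) measurableSet_unitCube
      pairwise_disjoint_unitCube (by rw [iUnion_unitCube]; exact hg.norm.integrableOn)
    simpa [iUnion_unitCube, setIntegral_unitCube fun x ↦ ‖g x‖] using this
  have h3 := hasSum_integral_of_summable_integral_norm
    (μ := volume.restrict (unitCube (0 : ι → ℤ))) (F := fun (m : ι → ℤ) x ↦ g (x + intVec m))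
    (fun m ↦ (hg.comp_add_right (intVec m)).integrableOn) h2.summable
  exact h1.unique h3

lemma mFourier_toTorus (k : ι → ℤ) (x : ι → ℝ) :
    UnitAddTorus.mFourier k (toTorus x) =
      Complex.exp (2 * Real.pi * Complex.I * (∑ i, (k i : ℝ) * x i : ℝ)) := by
  simp only [UnitAddTorus.mFourier, ContinuousMap.coe_mk, toTorus, fourier_coe_apply]
  rw [← Complex.exp_sum]
  push_cast
  rw [Finset.mul_sum]
  congr 1
  refine Finset.sum_congr rfl fun i _ ↦ ?_
  simp; ring

/-- The sum over `ℤ^ι` of `exp (-c |m|²)` is bounded by a product of one-dimensional theta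
series. -/
lemma summable_exp_neg_mul_sum_sq {c : ℝ} (hc : 0 < c) :
    Summable fun m : ι → ℤ ↦ Real.exp (-c * ∑ i, (m i : ℝ) ^ 2) := by
  classical
  have h1 : Summable fun n : ℤ ↦ Real.exp (-c * (n : ℝ) ^ 2) := by
    have h := (summable_jacobiTheta₂_term_iff 0 (Complex.I * (c / Real.pi : ℝ))).mpr (by
      simp; positivity)
    refine h.norm.congr fun n ↦ ?_
    rw [norm_jacobiTheta₂_term]
    congr 1
    simp
    field_simp
  refine summable_of_sum_le (fun _ ↦ (Real.exp_pos _).le)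
    (c := ∏ _i : ι, ∑' n : ℤ, Real.exp (-c * (n : ℝ) ^ 2)) fun u ↦ ?_
  let t : ι → Finset ℤ := fun i ↦ u.image fun m ↦ m i
  have hu : u ⊆ Fintype.piFinset t := fun m hm ↦
    Fintype.mem_piFinset.mpr fun i ↦ Finset.mem_image_of_mem _ hm
  calc ∑ m ∈ u, Real.exp (-c * ∑ i, (m i : ℝ) ^ 2)
      ≤ ∑ m ∈ Fintype.piFinset t, Real.exp (-c * ∑ i, (m i : ℝ) ^ 2) :=
        Finset.sum_le_sum_of_subset_of_nonneg hu fun _ _ _ ↦ (Real.exp_pos _).le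
    _ = ∏ i, ∑ n ∈ t i, Real.exp (-c * (n : ℝ) ^ 2) := by
        rw [Finset.prod_univ_sum]
        refine Finset.sum_congr rfl fun m _ ↦ ?_
        rw [Finset.mul_sum, Real.exp_sum]
    _ ≤ _ := Finset.prod_le_prod (fun i _ ↦ Finset.sum_nonneg fun _ _ ↦ (Real.exp_pos _).le)
        fun i _ ↦ h1.sum_le_tsum _ fun _ _ ↦ (Real.exp_pos _).le

/-- A nondegenerate quadratic form `|B x|²` is bounded below by a multiple of `|x|²`. -/
lemma exists_mul_sum_sq_le [DecidableEq ι] {B : Matrix ι ι ℝ} (hB : B.det ≠ 0) :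
    ∃ c > 0, ∀ x : ι → ℝ, c * ∑ i, x i ^ 2 ≤ ∑ i, (B.mulVec x) i ^ 2 := by
  let T : EuclideanSpace ℝ ι →L[ℝ] EuclideanSpace ℝ ι :=
    Matrix.toEuclideanCLM (𝕜 := ℝ) B⁻¹
  have key (x : ι → ℝ) : ∑ i, x i ^ 2 ≤ (‖T‖ ^ 2 + 1) * ∑ i, (B.mulVec x) i ^ 2 := by
    have h := T.le_opNorm (WithLp.toLp 2 (B.mulVec x))
    have h' : T (WithLp.toLp 2 (B.mulVec x)) = WithLp.toLp 2 x := by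
      simp [T, Matrix.nonsing_inv_mul _ (isUnit_iff_ne_zero.mpr hB)]
    rw [h'] at h
    have h2 := pow_le_pow_left₀ (norm_nonneg _) h 2
    rw [mul_pow, EuclideanSpace.norm_sq_eq, EuclideanSpace.norm_sq_eq] at h2
    simp only [Real.norm_eq_abs, sq_abs] at h2
    refine h2.trans ?_
    have : 0 ≤ ∑ i, (B.mulVec x) i ^ 2 := Finset.sum_nonneg fun _ _ ↦ sq_nonneg _
    nlinarith
  refine ⟨(‖T‖ ^ 2 + 1)⁻¹, by positivity, fun x ↦ ?_⟩
  rw [inv_mul_le_iff₀ (by positivity)]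
  exact key x

/-- The Gaussian `exp (-π |B x|²)`. -/
noncomputable def gaussian (B : Matrix ι ι ℝ) (x : ι → ℝ) : ℝ :=
  Real.exp (-Real.pi * ∑ i, (B.mulVec x) i ^ 2)

lemma gaussian_pos (B : Matrix ι ι ℝ) (x : ι → ℝ) : 0 < gaussian B x := Real.exp_pos _

lemma continuous_gaussian (B : Matrix ι ι ℝ) : Continuous (gaussian B) := by
  unfold gaussian
  have : Continuous fun x : ι → ℝ ↦ B.mulVec x :=
    Continuous.matrix_mulVec continuous_const continuous_id
  fun_prop

variable [DecidableEq ι]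

lemma exists_gaussian_le {B : Matrix ι ι ℝ} (hB : B.det ≠ 0) :
    ∃ c > 0, ∀ x, gaussian B x ≤ Real.exp (-c * ∑ i, x i ^ 2) := by
  obtain ⟨c, hc, h⟩ := exists_mul_sum_sq_le hB
  refine ⟨Real.pi * c, by positivity, fun x ↦ Real.exp_le_exp.mpr ?_⟩
  have := mul_le_mul_of_nonneg_left (h x) Real.pi_pos.le
  linarith

lemma summable_gaussian {B : Matrix ι ι ℝ} (hB : B.det ≠ 0) :
    Summable fun m : ι → ℤ ↦ gaussian B (intVec m) := by
  obtain ⟨c, hc, h⟩ := exists_gaussian_le hB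
  exact .of_nonneg_of_le (fun _ ↦ (gaussian_pos _ _).le) (fun m ↦ h _)
    (summable_exp_neg_mul_sum_sq hc)

/-- The periodization of a Gaussian is continuous, since it converges uniformly on bounded sets by
`|m|² ≤ 2 |x + m|² + 2 |x|²`. -/
lemma continuous_tsum_gaussian {B : Matrix ι ι ℝ} (hB : B.det ≠ 0) :
    Continuous fun x : ι → ℝ ↦ ∑' m : ι → ℤ, (gaussian B (x + intVec m) : ℂ) := by
  obtain ⟨c, hc, h⟩ := exists_gaussian_le hB
  rw [continuous_iff_continuousAt]
  intro x₀
  let U : Set (ι → ℝ) := {x | ∑ i, x i ^ 2 < ∑ i, x₀ i ^ 2 + 1}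
  have hU : U ∈ nhds x₀ := by
    refine (isOpen_lt (by fun_prop) (by fun_prop)).mem_nhds ?_
    simp
  refine ContinuousOn.continuousAt (s := U) ?_ hU
  refine continuousOn_tsum (u := fun m : ι → ℤ ↦ Real.exp (c * (∑ i, x₀ i ^ 2 + 1)) *
    Real.exp (-(c / 2) * ∑ i, (m i : ℝ) ^ 2)) (fun m ↦ ?_) ?_ fun m x hx ↦ ?_
  · exact (Complex.continuous_ofReal.comp ((continuous_gaussian B).comp
      (by fun_prop))).continuousOn
  · exact (summable_exp_neg_mul_sum_sq (by positivity)).mul_left _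
  · rw [Complex.norm_real, Real.norm_of_nonneg (gaussian_pos _ _).le, ← Real.exp_add]
    refine (h _).trans (Real.exp_le_exp.mpr ?_)
    have h1 : ∑ i, (m i : ℝ) ^ 2 ≤ 2 * ∑ i, (x + intVec m) i ^ 2 + 2 * ∑ i, x i ^ 2 := by
      rw [Finset.mul_sum, Finset.mul_sum, ← Finset.sum_add_distrib]
      refine Finset.sum_le_sum fun i _ ↦ ?_
      simp only [Pi.add_apply]
      nlinarith [sq_nonneg (2 * x i + m i)]
    have h2 : ∑ i, x i ^ 2 < ∑ i, x₀ i ^ 2 + 1 := hx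
    nlinarith

lemma integral_comp_mulVec {B : Matrix ι ι ℝ} (hB : B.det ≠ 0) (g : (ι → ℝ) → ℂ) :
    ∫ x, g (B.mulVec x) = (|B.det|⁻¹ : ℝ) * ∫ x, g x := by
  have h := Real.map_matrix_volume_pi_eq_smul_volume_pi hB
  have he : MeasurableEmbedding (Matrix.toLin' B) := by
    have hBu := (Matrix.isUnit_iff_isUnit_det _).mpr (isUnit_iff_ne_zero.mpr hB)
    let e := Matrix.toLinearEquiv' B hBu.invertible
    exact e.toContinuousLinearEquiv.toHomeomorph.measurableEmbedding
  have h2 := he.integral_map (μ := volume) g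
  rw [h, integral_smul_measure, ENNReal.toReal_ofReal (by positivity), abs_inv] at h2
  simpa using h2.symm

lemma integrable_comp_mulVec {B : Matrix ι ι ℝ} (hB : B.det ≠ 0) {g : (ι → ℝ) → ℂ}
    (hg : Integrable g) : Integrable fun x ↦ g (B.mulVec x) := by
  have h := Real.map_matrix_volume_pi_eq_smul_volume_pi hB
  refine Integrable.comp_measurable (g := g) (f := Matrix.toLin' B) ?_ ?_
  · rw [h]; exact hg.smul_measure (by simp)
  · exact (LinearMap.continuous_of_finiteDimensional _).measurable

/-- The Fourier transform of the Gaussian `exp (-π |B x|²)`. -/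
lemma integral_gaussian_mul_exp {B : Matrix ι ι ℝ} (hB : B.det ≠ 0) (k : ι → ℝ) :
    ∫ x, Complex.exp (-2 * Real.pi * Complex.I * (∑ i, k i * x i : ℝ)) * gaussian B x =
      (|B.det|⁻¹ : ℝ) * gaussian B⁻¹.transpose k := by
  set c : ι → ℂ := fun i ↦ -2 * Real.pi * Complex.I * (B⁻¹.transpose.mulVec k i : ℝ)
  have hu := isUnit_iff_ne_zero.mpr hB
  have h1 (x : ι → ℝ) : Complex.exp (-2 * Real.pi * Complex.I * (∑ i, k i * x i : ℝ)) * gaussian B x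
      = (fun v : ι → ℝ ↦ Complex.exp (-Real.pi * ∑ i, (v i : ℂ) ^ 2 + ∑ i, c i * v i))
        (B.mulVec x) := by
    have : ∑ i, k i * x i = ∑ i, B⁻¹.transpose.mulVec k i * B.mulVec x i := by
      change k ⬝ᵥ x = B⁻¹.transpose.mulVec k ⬝ᵥ B.mulVec x
      rw [Matrix.mulVec_transpose, ← Matrix.dotProduct_mulVec, Matrix.mulVec_mulVec,
        Matrix.nonsing_inv_mul _ hu, Matrix.one_mulVec]
    rw [this, gaussian, Complex.ofReal_exp, ← Complex.exp_add]
    simp only [c]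
    push_cast
    rw [Finset.mul_sum, add_comm]
    congr 2
    exact Finset.sum_congr rfl fun i _ ↦ by ring
  simp_rw [h1]
  rw [integral_comp_mulVec hB (fun v : ι → ℝ ↦
    Complex.exp (-Real.pi * ∑ i, (v i : ℂ) ^ 2 + ∑ i, c i * v i)),
    GaussianFourier.integral_cexp_neg_mul_sum_add (by simpa using Real.pi_pos),
    div_self (by simp [Real.pi_ne_zero]), Complex.one_cpow, one_mul, gaussian, Complex.ofReal_exp]
  congr 2
  have hpi : (Real.pi : ℂ) ≠ 0 := by simp [Real.pi_ne_zero]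
  push_cast
  rw [Finset.sum_div, Finset.mul_sum]
  refine Finset.sum_congr rfl fun i _ ↦ ?_
  simp only [c]
  field_simp
  rw [Complex.I_sq]
  ring

/-- **Poisson summation** for the Gaussian `exp (-π |B x|²)`. -/
theorem tsum_gaussian {B : Matrix ι ι ℝ} (hB : B.det ≠ 0) :
    ∑' m : ι → ℤ, gaussian B (intVec m) =
      |B.det|⁻¹ * ∑' m : ι → ℤ, gaussian B⁻¹.transpose (intVec m) := by
  -- the periodization of the Gaussian
  set P : (ι → ℝ) → ℂ := fun x ↦ ∑' m : ι → ℤ, (gaussian B (x + intVec m) : ℂ)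
  have hPper (x y : ι → ℝ) (hxy : toTorus x = toTorus y) : P x = P y := by
    have h (i : ι) : ∃ n : ℤ, y i = x i + n := by
      obtain ⟨n, hn⟩ := QuotientAddGroup.eq.mp (congrFun hxy i)
      have hn' : (n : ℝ) = -x i + y i := by simpa using hn
      exact ⟨n, by linarith⟩
    choose n hn using h
    have hy : y = x + intVec n := funext hn
    rw [hy]
    refine (Equiv.tsum_eq (Equiv.addLeft n) _).symm.trans ?_
    refine tsum_congr fun m ↦ ?_
    congr 2
    ext i
    simp only [Pi.add_apply, intVec, Equiv.coe_addLeft, Int.cast_add]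
    ring
  let s : UnitAddTorus ι → ι → ℝ := Function.surjInv isOpenQuotientMap_toTorus.surjective
  have hs (y) : toTorus (s y) = y := Function.surjInv_eq isOpenQuotientMap_toTorus.surjective y
  let f : C(UnitAddTorus ι, ℂ) := ⟨fun y ↦ P (s y), by
    rw [isOpenQuotientMap_toTorus.isQuotientMap.continuous_iff]
    refine (continuous_tsum_gaussian hB).congr fun x ↦ ?_
    exact hPper _ _ (hs _).symm⟩
  have hf (x : ι → ℝ) : f (toTorus x) = P x := hPper _ _ (hs _)
  have hBt : B⁻¹.transpose.det ≠ 0 := by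
    rw [Matrix.det_transpose, Matrix.det_nonsing_inv, Ring.inverse_eq_inv']
    exact inv_ne_zero hB
  -- unfolding the integral over the torus turns the Fourier coefficients of the periodization into
  -- values of the Fourier transform of the Gaussian
  have hcoeff (k : ι → ℤ) : UnitAddTorus.mFourierCoeff f k =
      ((|B.det|⁻¹ * gaussian B⁻¹.transpose (intVec k) : ℝ) : ℂ) := by
    have hint : Integrable fun x ↦ Complex.exp (-2 * Real.pi * Complex.I *
        (∑ i, intVec k i * x i : ℝ)) * gaussian B x := by
      have h0 : Integrable fun x : ι → ℝ ↦ (gaussian B x : ℂ) := by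
        have := integrable_comp_mulVec hB (GaussianFourier.integrable_cexp_neg_mul_sum_add
          (b := Real.pi) (by simpa using Real.pi_pos) (0 : ι → ℂ))
        refine this.congr (.of_forall fun x ↦ ?_)
        simp [gaussian]
      refine h0.bdd_mul (c := 1)
        (Continuous.aestronglyMeasurable (by fun_prop)) (.of_forall fun x ↦ ?_)
      rw [show -2 * Real.pi * Complex.I * (∑ i, intVec k i * x i : ℝ) =
        ((-2 * Real.pi * ∑ i, intVec k i * x i : ℝ) : ℂ) * Complex.I by push_cast; ring,
        Complex.norm_exp_ofReal_mul_I]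
    have h := integral_eq_integral_tsum hint
    rw [integral_gaussian_mul_exp hB] at h
    rw [UnitAddTorus.mFourierCoeff_eq_integral f k 0, Complex.ofReal_mul, h]
    have hcube : {x : ι → ℝ | ∀ i, x i ∈ Set.Ioc ((0 : ι → ℝ) i) ((0 : ι → ℝ) i + 1)} =
        unitCube 0 := by simp [unitCube]
    rw [hcube]
    refine integral_congr_ae (.of_forall fun x ↦ ?_)
    change UnitAddTorus.mFourier (-k) (toTorus x) • f (toTorus x) = _
    rw [hf, mFourier_toTorus, smul_eq_mul, ← tsum_mul_left]
    refine tsum_congr fun m ↦ ?_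
    congr 1
    rw [Complex.exp_eq_exp_iff_exists_int]
    refine ⟨∑ i, k i * m i, ?_⟩
    simp only [Pi.neg_apply, Pi.add_apply, Int.cast_neg, neg_mul, Finset.sum_neg_distrib, mul_add,
      Finset.sum_add_distrib]
    push_cast
    ring
  have hsum : Summable (UnitAddTorus.mFourierCoeff f) := by
    simp_rw [funext hcoeff]
    exact Complex.ofRealCLM.summable ((summable_gaussian hBt).mul_left _)
  -- compare the values of the Fourier series and of the periodization at the origin
  have h := (UnitAddTorus.hasSum_mFourier_series_apply_of_summable hsum (toTorus 0)).tsum_eq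
  rw [hf] at h
  simp only [mFourier_toTorus, hcoeff] at h
  simp only [Pi.zero_apply, mul_zero, Finset.sum_const_zero, Complex.ofReal_zero, Complex.exp_zero,
    smul_eq_mul, mul_one, P, zero_add] at h
  rw [← Complex.ofReal_tsum, ← Complex.ofReal_tsum, Complex.ofReal_inj, tsum_mul_left] at h
  exact h.symm

open scoped MatrixOrder in
lemma _root_.Matrix.PosDef.exists_eq_transpose_mul {Q : Matrix ι ι ℝ} (hQ : Q.PosDef) :
    ∃ B : Matrix ι ι ℝ, Q = B.transpose * B ∧ B.det ≠ 0 := by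
  obtain ⟨B, hB⟩ := CStarAlgebra.nonneg_iff_eq_star_mul_self.mp hQ.posSemidef.nonneg
  have hB' : Q = B.transpose * B := by
    rw [hB, Matrix.star_eq_conjTranspose, Matrix.conjTranspose_eq_transpose_of_trivial]
  refine ⟨B, hB', fun h ↦ hQ.det_pos.ne' ?_⟩
  rw [hB', Matrix.det_mul, h, mul_zero]

/-- The theta transformation formula for a positive definite quadratic form. -/
theorem tsum_exp_neg_posDef {Q : Matrix ι ι ℝ} (hQ : Q.PosDef) :
    ∑' m : ι → ℤ, Real.exp (-Real.pi * (intVec m ⬝ᵥ Q.mulVec (intVec m))) =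
      (√Q.det)⁻¹ * ∑' m : ι → ℤ, Real.exp (-Real.pi * (intVec m ⬝ᵥ Q⁻¹.mulVec (intVec m))) := by
  obtain ⟨B, hQB, hB⟩ := hQ.exists_eq_transpose_mul
  have h1 (x : ι → ℝ) : x ⬝ᵥ Q.mulVec x = ∑ i, B.mulVec x i ^ 2 := by
    rw [hQB, ← Matrix.mulVec_mulVec, Matrix.dotProduct_mulVec, Matrix.vecMul_transpose]
    exact Finset.sum_congr rfl fun i _ ↦ (sq _).symm
  have h2 (x : ι → ℝ) : x ⬝ᵥ Q⁻¹.mulVec x = ∑ i, B⁻¹.transpose.mulVec x i ^ 2 := by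
    rw [hQB, Matrix.mul_inv_rev, ← Matrix.mulVec_mulVec, Matrix.dotProduct_mulVec,
      ← Matrix.transpose_nonsing_inv, ← Matrix.mulVec_transpose]
    exact Finset.sum_congr rfl fun i _ ↦ (sq _).symm
  have h3 : √Q.det = |B.det| := by
    rw [hQB, Matrix.det_mul, Matrix.det_transpose, Real.sqrt_mul_self_eq_abs]
  simp_rw [h1, h2, h3]
  exact tsum_gaussian hB

lemma summable_exp_neg_posDef {Q : Matrix ι ι ℝ} (hQ : Q.PosDef) :
    Summable fun m : ι → ℤ ↦ Real.exp (-Real.pi * (intVec m ⬝ᵥ Q.mulVec (intVec m))) := by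
  obtain ⟨B, hQB, hB⟩ := hQ.exists_eq_transpose_mul
  have h1 (x : ι → ℝ) : x ⬝ᵥ Q.mulVec x = ∑ i, B.mulVec x i ^ 2 := by
    rw [hQB, ← Matrix.mulVec_mulVec, Matrix.dotProduct_mulVec, Matrix.vecMul_transpose]
    exact Finset.sum_congr rfl fun i _ ↦ (sq _).symm
  simp_rw [h1]
  exact summable_gaussian hB

end GaussianSums

/-! ### The Riemann–Roch theorem -/

section RiemannRoch
variable {F : Type*} [Field F] [NumberField F]

lemma ideal_ne_zero (D : Divisor F) : ideal D ≠ 0 :=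
  Finset.prod_ne_zero_iff.mpr fun v _ ↦
    zpow_ne_zero _ (FractionalIdeal.coeIdeal_ne_zero.mpr v.ne_bot)

lemma ideal_zero : ideal (0 : Divisor F) = 1 := Finsupp.prod_zero_index

lemma ideal_neg (D : Divisor F) : ideal (-D) = (ideal D)⁻¹ := by
  refine eq_inv_of_mul_eq_one_left ?_
  rw [← ideal_add, neg_add_cancel, ideal_zero]

lemma absNorm_ideal (D : Divisor F) : ((FractionalIdeal.absNorm (ideal D) : ℚ) : ℝ) =
    Real.exp (-(D.1.sum fun P x ↦ Real.log (Ideal.absNorm P.asIdeal) * x)) := by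
  rw [ideal, Finsupp.prod, map_prod, Finsupp.sum, ← Finset.sum_neg_distrib, Real.exp_sum]
  push_cast
  refine Finset.prod_congr rfl fun P _ ↦ ?_
  have hP : 0 < (Ideal.absNorm P.asIdeal : ℝ) := by
    exact_mod_cast Nat.pos_of_ne_zero (mt Ideal.absNorm_eq_zero_iff.mp P.ne_bot)
  rw [map_zpow₀, FractionalIdeal.coeIdeal_absNorm, ← mul_neg, ← Int.cast_neg,
    ← Real.rpow_def_of_pos hP, Real.rpow_intCast]
  push_cast
  rfl

lemma absNorm_ideal_pos (D : Divisor F) :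
    0 < ((FractionalIdeal.absNorm (ideal D) : ℚ) : ℝ) := by
  rw [absNorm_ideal]; exact Real.exp_pos _

lemma norm_eq_exp_div_absNorm (D : Divisor F) :
    norm D = Real.exp (∑ σ, D.2 σ) / (FractionalIdeal.absNorm (ideal D) : ℚ) := by
  rw [absNorm_ideal, ← Real.exp_sub, norm, degree]
  congr 1
  ring

/-- The ideal of `κ - D` is the dual of the ideal of `D` under the trace form. -/
lemma ideal_canonicalDivisor_sub (D : Divisor F) :
    ideal (canonicalDivisor F - D) = FractionalIdeal.dual ℤ ℚ (ideal D) := by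
  have h0 : (differentIdeal ℤ (𝓞 F) : FractionalIdeal (𝓞 F)⁰ F) ≠ 0 :=
    FractionalIdeal.coeIdeal_ne_zero.mpr differentIdeal_ne_bot
  have h : ideal (canonicalDivisor F) = FractionalIdeal.dual ℤ ℚ 1 := by
    refine (ideal_idealDivisor h0).trans ?_
    rw [coeIdeal_differentIdeal (K := ℚ), inv_inv]
  rw [sub_eq_add_neg, ideal_add, ideal_neg, h, ← FractionalIdeal.dual_eq_mul_inv]

/-- The weight of a complex embedding in the quadratic form `‖f‖_D²`. -/
noncomputable def weight (D : Divisor F) (φ : F →+* ℂ) : ℝ :=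
  Real.exp (-2 * D.2 (InfinitePlace.mk φ) / (InfinitePlace.mk φ).mult)

lemma weight_pos (D : Divisor F) (φ : F →+* ℂ) : 0 < weight D φ := Real.exp_pos _

lemma weight_conjugate (D : Divisor F) (φ : F →+* ℂ) :
    weight D (ComplexEmbedding.conjugate φ) = weight D φ := by
  rw [weight, weight, InfinitePlace.mk_conjugate_eq]

lemma weight_canonicalDivisor_sub (D : Divisor F) (φ : F →+* ℂ) :
    weight (canonicalDivisor F - D) φ = (weight D φ)⁻¹ := by
  rw [weight, weight, ← Real.exp_neg]
  congr 1
  simp only [canonicalDivisor, Prod.snd_sub, Pi.sub_apply, Pi.zero_apply]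
  ring

lemma sum_embeddings_eq_sum_mult (g : InfinitePlace F → ℝ) :
    ∑ φ : F →+* ℂ, g (InfinitePlace.mk φ) = ∑ σ : InfinitePlace F, σ.mult * g σ := by
  classical
  rw [← Finset.sum_fiberwise_of_maps_to (g := InfinitePlace.mk) (t := Finset.univ)
    fun _ _ ↦ Finset.mem_univ _]
  refine Finset.sum_congr rfl fun σ _ ↦ ?_
  rw [Finset.sum_congr rfl fun φ hφ ↦ by rw [(Finset.mem_filter.mp hφ).2], Finset.sum_const,
    InfinitePlace.card_filter_mk_eq, nsmul_eq_mul]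

lemma normSq_eq_sum_embeddings (D : Divisor F) (f : F) :
    normSq D f = ∑ φ : F →+* ℂ, weight D φ * ‖φ f‖ ^ 2 := by
  have h := sum_embeddings_eq_sum_mult (F := F) fun σ ↦
    Real.exp (-2 * D.2 σ / σ.mult) * σ f ^ 2
  simp only [InfinitePlace.apply] at h
  simp only [weight, h, normSq]
  exact Finset.sum_congr rfl fun σ _ ↦ by ring

lemma prod_weight (D : Divisor F) :
    ∏ φ : F →+* ℂ, weight D φ = Real.exp (-2 * ∑ σ, D.2 σ) := by
  have h := sum_embeddings_eq_sum_mult (F := F) fun σ ↦ -2 * D.2 σ / σ.mult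
  simp only [weight]
  rw [← Real.exp_sum, h, Finset.mul_sum]
  congr 1
  refine Finset.sum_congr rfl fun σ _ ↦ ?_
  have : (σ.mult : ℝ) ≠ 0 := InfinitePlace.mult_coe_ne_zero
  field_simp

section Gram

variable {ι : Type*} [Fintype ι]

/-- The matrix of the quadratic form `f ↦ ‖f‖_D²` in a `ℚ`-basis of `F`. -/
noncomputable def gramMatrix (D : Divisor F) (b : Module.Basis ι ℚ F) : Matrix ι ι ℝ :=
  .of fun i j ↦ ∑ φ : F →+* ℂ, weight D φ * (star (φ (b i)) * φ (b j)).re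

lemma dotProduct_gramMatrix (D : Divisor F) (b : Module.Basis ι ℚ F) (x : ι → ℝ) :
    x ⬝ᵥ (gramMatrix D b).mulVec x =
      ∑ φ : F →+* ℂ, weight D φ * ‖∑ i, (x i : ℂ) * φ (b i)‖ ^ 2 := by
  have h (φ : F →+* ℂ) : ‖∑ i, (x i : ℂ) * φ (b i)‖ ^ 2 =
      ∑ i, ∑ j, x i * x j * (star (φ (b i)) * φ (b j)).re := by
    have h1 : ((‖∑ i, (x i : ℂ) * φ (b i)‖ ^ 2 : ℝ) : ℂ) = star (∑ i, (x i : ℂ) * φ (b i)) *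
        ∑ i, (x i : ℂ) * φ (b i) := by
      rw [Complex.ofReal_pow]; exact (Complex.conj_mul' _).symm
    have h2 := congrArg Complex.re h1
    rw [Complex.ofReal_re] at h2
    rw [h2, star_sum, Finset.sum_mul_sum, Complex.re_sum]
    refine Finset.sum_congr rfl fun i _ ↦ ?_
    rw [Complex.re_sum]
    refine Finset.sum_congr rfl fun j _ ↦ ?_
    rw [star_mul', ← Complex.re_ofReal_mul, RCLike.star_def, Complex.conj_ofReal]
    push_cast
    congr 1; ring
  simp_rw [h, dotProduct, Matrix.mulVec, dotProduct, gramMatrix, Matrix.of_apply, Finset.mul_sum,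
    Finset.sum_mul, Finset.mul_sum]
  rw [Finset.sum_comm (s := (Finset.univ : Finset (F →+* ℂ)))]
  refine Finset.sum_congr rfl fun i _ ↦ ?_
  rw [Finset.sum_comm]
  exact Finset.sum_congr rfl fun φ _ ↦ Finset.sum_congr rfl fun j _ ↦ by ring

lemma dotProduct_gramMatrix_intVec (D : Divisor F) (b : Module.Basis ι ℚ F) (m : ι → ℤ) :
    intVec m ⬝ᵥ (gramMatrix D b).mulVec (intVec m) = normSq D (∑ i, m i • b i) := by
  rw [dotProduct_gramMatrix, normSq_eq_sum_embeddings]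
  simp [map_sum]

variable (F) in
lemma card_basis_eq_card_embeddings (b : Module.Basis ι ℚ F) :
    Fintype.card ι = Fintype.card (F →+* ℂ) := by
  rw [Embeddings.card, Module.finrank_eq_card_basis b]

variable [DecidableEq ι]

/-- The matrix of the complex embeddings of the elements of a basis. -/
noncomputable def embMatrix (b : Module.Basis ι ℚ F) (e : ι ≃ (F →+* ℂ)) : Matrix ι ι ℂ :=
  .of fun i k ↦ e k (b i)

/-- The Gram matrix is `M̄ W Mᵀ`, where `M` is the matrix of the embeddings of the basis and `W` is
the diagonal matrix of the weights; its entries are real because `W` is invariant under complex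
conjugation. -/
lemma gramMatrix_map (D : Divisor F) (b : Module.Basis ι ℚ F) (e : ι ≃ (F →+* ℂ)) :
    (gramMatrix D b).map Complex.ofReal = (embMatrix b e).map star *
      Matrix.diagonal (fun k ↦ (weight D (e k) : ℂ)) * (embMatrix b e).transpose := by
  ext i j
  have h1 : ∑ φ : F →+* ℂ, (weight D φ : ℂ) * (star (φ (b i)) * φ (b j)) =
      ((∑ φ : F →+* ℂ, weight D φ * (star (φ (b i)) * φ (b j)).re : ℝ) : ℂ) := by
    refine (Complex.conj_eq_iff_re.mp ?_).symm.trans ?_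
    · rw [map_sum]
      refine Fintype.sum_equiv (Equiv.ofBijective _
        (ComplexEmbedding.involutive_conjugate F).bijective) _ _ fun φ ↦ ?_
      simp only [Equiv.ofBijective_apply, weight_conjugate, ComplexEmbedding.conjugate_coe_eq,
        map_mul, Complex.conj_ofReal, RCLike.star_def]
    · congr 1
      simp
  rw [Matrix.map_apply, gramMatrix, Matrix.of_apply, ← h1, ← e.sum_comp]
  rw [Matrix.mul_apply]
  simp only [Matrix.mul_diagonal, Matrix.map_apply, embMatrix, Matrix.of_apply,
    Matrix.transpose_apply]
  exact Finset.sum_congr rfl fun k _ ↦ by ring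

lemma det_embMatrix_sq (b : Module.Basis ι ℚ F) (e : ι ≃ (F →+* ℂ)) :
    (embMatrix b e).det ^ 2 = ((Algebra.discr ℚ b : ℚ) : ℂ) := by
  exact (Algebra.discr_eq_det_embeddingsMatrixReindex_pow_two ℚ ℂ b
    (e.trans (RingHom.equivRatAlgHom F ℂ))).symm

lemma det_embMatrix_ne_zero (b : Module.Basis ι ℚ F) (e : ι ≃ (F →+* ℂ)) :
    (embMatrix b e).det ≠ 0 := by
  have h := det_embMatrix_sq b e
  intro h0
  rw [h0, zero_pow two_ne_zero, eq_comm, Rat.cast_eq_zero] at h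
  exact Algebra.discr_not_zero_of_basis ℚ b h

/-- The entries of this product are the traces of the products `b i * b.traceDual j`. -/
lemma embMatrix_mul_transpose_traceDual (b : Module.Basis ι ℚ F) (e : ι ≃ (F →+* ℂ)) :
    embMatrix b e * (embMatrix b.traceDual e).transpose = 1 := by
  ext i j
  have h := trace_eq_sum_embeddings ℂ (K := ℚ) (x := b i * b.traceDual j)
  rw [b.trace_mul_traceDual i j] at h
  rw [Matrix.mul_apply, Matrix.one_apply]
  simp only [embMatrix, Matrix.of_apply, Matrix.transpose_apply, ← map_mul]
  rw [e.sum_comp fun φ ↦ φ (b i * b.traceDual j)]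
  refine ((RingHom.equivRatAlgHom F ℂ).sum_comp
    fun φ : F →ₐ[ℚ] ℂ ↦ φ (b i * b.traceDual j)).trans ?_
  rw [← h]
  split_ifs <;> simp

lemma posDef_gramMatrix (D : Divisor F) (b : Module.Basis ι ℚ F) : (gramMatrix D b).PosDef := by
  let e := Fintype.equivOfCardEq (card_basis_eq_card_embeddings F b)
  refine .of_dotProduct_mulVec_pos ?_ fun x hx ↦ ?_
  · ext i j
    simp only [Matrix.conjTranspose_apply, gramMatrix, Matrix.of_apply, star_trivial]
    refine Finset.sum_congr rfl fun φ _ ↦ ?_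
    simp [mul_comm]
  · rw [star_trivial, dotProduct_gramMatrix]
    refine Finset.sum_pos' (fun φ _ ↦ mul_nonneg (weight_pos D φ).le (sq_nonneg _)) ?_
    by_contra! h
    have h0 (φ : F →+* ℂ) : ∑ i, (x i : ℂ) * φ (b i) = 0 := by
      have h1 := h φ (Finset.mem_univ φ)
      by_contra h2
      exact h1.not_gt (mul_pos (weight_pos D φ) (by positivity))
    have h3 : Matrix.vecMul (fun i ↦ (x i : ℂ)) (embMatrix b e) = 0 := funext fun k ↦ h0 (e k)
    have h4 := Matrix.eq_zero_of_vecMul_eq_zero (det_embMatrix_ne_zero b e) h3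
    exact hx (funext fun i ↦ by simpa using congrFun h4 i)

/-- The quadratic form of `κ - D` on the trace dual lattice is the dual of that of `D`. -/
lemma gramMatrix_inv (D : Divisor F) (b : Module.Basis ι ℚ F) :
    (gramMatrix D b)⁻¹ = gramMatrix (canonicalDivisor F - D) b.traceDual := by
  let e := Fintype.equivOfCardEq (card_basis_eq_card_embeddings F b)
  refine Matrix.inv_eq_right_inv ?_
  have hinj : Function.Injective (fun A : Matrix ι ι ℝ ↦ A.map Complex.ofReal) :=
    Matrix.map_injective Complex.ofReal_injective
  apply hinj
  have hsymm : (gramMatrix (canonicalDivisor F - D) b.traceDual).map Complex.ofReal =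
      embMatrix b.traceDual e * Matrix.diagonal (fun k ↦ ((weight D (e k) : ℂ))⁻¹) *
        ((embMatrix b.traceDual e).map star).transpose := by
    have h := congrArg Matrix.transpose (gramMatrix_map (canonicalDivisor F - D) b.traceDual e)
    have h' := (posDef_gramMatrix (canonicalDivisor F - D) b.traceDual).isHermitian
    rw [Matrix.IsHermitian, Matrix.conjTranspose_eq_transpose_of_trivial] at h'
    rw [← Matrix.transpose_map, h'] at h
    rw [h]
    simp only [Matrix.transpose_mul, Matrix.transpose_transpose, Matrix.diagonal_transpose,
      Matrix.mul_assoc, weight_canonicalDivisor_sub, Complex.ofReal_inv]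
  set M := embMatrix b e
  set M' := embMatrix b.traceDual e
  have h1 : M * M'.transpose = 1 := embMatrix_mul_transpose_traceDual b e
  have h2 : M.transpose * M' = 1 := by
    rw [mul_eq_one_comm, ← Matrix.transpose_one, ← h1, Matrix.transpose_mul,
      Matrix.transpose_transpose]
  have h3 : Matrix.diagonal (fun k ↦ (weight D (e k) : ℂ)) *
      Matrix.diagonal (fun k ↦ ((weight D (e k) : ℂ))⁻¹) = 1 := by
    rw [Matrix.diagonal_mul_diagonal, ← Matrix.diagonal_one]
    congr 1
    ext k
    exact mul_inv_cancel₀ (by exact_mod_cast (weight_pos D (e k)).ne')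
  have h4 : M.map star * (M'.map star).transpose = 1 := by
    have h := congrArg (fun A : Matrix ι ι ℂ ↦ A.map (starRingEnd ℂ)) h1
    rw [Matrix.map_mul, Matrix.map_one _ (map_zero (starRingEnd ℂ)) (map_one _)] at h
    exact h
  calc (gramMatrix D b * gramMatrix (canonicalDivisor F - D) b.traceDual).map Complex.ofReal
      = (gramMatrix D b).map Complex.ofReal *
        (gramMatrix (canonicalDivisor F - D) b.traceDual).map Complex.ofReal :=
        Matrix.map_mul (f := Complex.ofRealHom)
    _ = M.map star * Matrix.diagonal (fun k ↦ (weight D (e k) : ℂ)) * (M.transpose * M') *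
        Matrix.diagonal (fun k ↦ ((weight D (e k) : ℂ))⁻¹) * (M'.map star).transpose := by
        rw [gramMatrix_map D b e, hsymm]
        simp only [Matrix.mul_assoc]
        rfl
    _ = M.map star * (Matrix.diagonal (fun k ↦ (weight D (e k) : ℂ)) *
        Matrix.diagonal (fun k ↦ ((weight D (e k) : ℂ))⁻¹)) * (M'.map star).transpose := by
        rw [h2, mul_one, Matrix.mul_assoc (M.map star)]
    _ = (1 : Matrix ι ι ℝ).map Complex.ofReal := by
        rw [h3, mul_one, h4]
        exact (Matrix.map_one _ Complex.ofReal_zero Complex.ofReal_one).symm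

lemma det_gramMatrix (D : Divisor F) (b : Module.Basis ι ℚ F) :
    (gramMatrix D b).det = |((Algebra.discr ℚ b : ℚ) : ℝ)| * Real.exp (-2 * ∑ σ, D.2 σ) := by
  let e := Fintype.equivOfCardEq (card_basis_eq_card_embeddings F b)
  have h := congrArg Matrix.det (gramMatrix_map D b e)
  rw [Matrix.det_mul, Matrix.det_mul, Matrix.det_diagonal, Matrix.det_transpose] at h
  have h1 : ((embMatrix b e).map star).det = star (embMatrix b e).det :=
    (RingHom.map_det (starRingEnd ℂ) _).symm
  have h2 : ((gramMatrix D b).map Complex.ofReal).det = ((gramMatrix D b).det : ℂ) :=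
    (RingHom.map_det Complex.ofRealHom _).symm
  have h3 : star (embMatrix b e).det * (embMatrix b e).det =
      (|((Algebra.discr ℚ b : ℚ) : ℝ)| : ℝ) := by
    rw [RCLike.star_def, Complex.conj_mul', ← Complex.ofReal_pow, ← norm_pow,
      det_embMatrix_sq]
    congr 1
    rw [← Complex.ofReal_ratCast, Complex.norm_real, Real.norm_eq_abs]
  rw [h1, h2, e.prod_comp fun φ ↦ (weight D φ : ℂ), mul_right_comm, h3, ← Complex.ofReal_prod,
    prod_weight] at h
  exact_mod_cast h

/-- The discriminant of a basis of a fractional ideal `I` is `N(I)² Δ`. -/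
lemma discr_basisOfFractionalIdeal (I : (FractionalIdeal (𝓞 F)⁰ F)ˣ)
    [DecidableEq (Module.Free.ChooseBasisIndex ℤ I)] :
    Algebra.discr ℚ (basisOfFractionalIdeal F I) =
      FractionalIdeal.absNorm (I : FractionalIdeal (𝓞 F)⁰ F) ^ 2 * discr F := by
  let e : Module.Free.ChooseBasisIndex ℤ (𝓞 F) ≃ Module.Free.ChooseBasisIndex ℤ I :=
    Fintype.equivOfCardEq (by
      rw [← Module.finrank_eq_card_chooseBasisIndex, ← Module.finrank_eq_card_chooseBasisIndex,
        fractionalIdeal_rank])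
  have h := det_basisOfFractionalIdeal_eq_absNorm F I e
  have h2 := Algebra.discr_of_matrix_vecMul (A := ℚ) (integralBasis F)
    ((integralBasis F).toMatrix ((basisOfFractionalIdeal F I).reindex e.symm))
  rw [Module.Basis.toMatrix_map_vecMul, ← Module.Basis.det_apply, ← sq_abs, h, ← coe_discr,
    Module.Basis.coe_reindex, Algebra.discr_reindex] at h2
  exact h2

end Gram

/-- An ideal lattice is parametrized by the integer vectors. -/
lemma exists_equiv_ideal {ι : Type*} [Fintype ι] (D : Divisor F) (b : Module.Basis ι ℚ F)
    (hb : ∀ x, x ∈ Submodule.span ℤ (Set.range b) ↔ x ∈ ideal D) :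
    ∃ e : (ι → ℤ) ≃ {f : F // f ∈ ideal D}, ∀ m, (e m : F) = ∑ i, m i • b i := by
  have hm (m : ι → ℤ) : ∑ i, m i • b i ∈ ideal D := by
    rw [← hb, Submodule.mem_span_range_iff_exists_fun]
    exact ⟨m, rfl⟩
  refine ⟨Equiv.ofBijective (fun m ↦ ⟨∑ i, m i • b i, hm m⟩) ⟨fun m n h ↦ ?_, fun x ↦ ?_⟩,
    fun m ↦ rfl⟩
  · have h' : ∑ i, m i • b i = ∑ i, n i • b i := congrArg Subtype.val h
    simp_rw [← Int.cast_smul_eq_zsmul ℚ] at h'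
    rw [← b.equivFun_symm_apply, ← b.equivFun_symm_apply] at h'
    have := b.equivFun.symm.injective h'
    exact funext fun i ↦ by exact_mod_cast congrFun this i
  · obtain ⟨c, hc⟩ := (Submodule.mem_span_range_iff_exists_fun ℤ).mp ((hb x).mpr x.2)
    exact ⟨c, Subtype.ext hc⟩

/-- The ideal of a divisor has a `ℤ`-basis, of discriminant `N(I)² Δ`. -/
lemma exists_basis_ideal (D : Divisor F) :
    ∃ b : Module.Basis (Fin (Module.finrank ℚ F)) ℚ F,
      (∀ x, x ∈ Submodule.span ℤ (Set.range b) ↔ x ∈ ideal D) ∧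
      Algebra.discr ℚ b = FractionalIdeal.absNorm (ideal D) ^ 2 * discr F := by
  classical
  let I := Units.mk0 _ (ideal_ne_zero D)
  let b := basisOfFractionalIdeal F I
  let e := Fintype.equivFinOfCardEq (Module.finrank_eq_card_basis b).symm
  refine ⟨b.reindex e, fun x ↦ ?_, ?_⟩
  · rw [Module.Basis.range_reindex]
    exact mem_span_basisOfFractionalIdeal F (I := I)
  · rw [Module.Basis.coe_reindex, Algebra.discr_reindex]
    exact discr_basisOfFractionalIdeal I

lemma summable_k0 (D : Divisor F) :
    Summable fun f : {f : F // f ∈ ideal D} ↦ Real.exp (-Real.pi * normSq D f) := by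
  obtain ⟨b, hb, -⟩ := exists_basis_ideal D
  obtain ⟨e, he⟩ := exists_equiv_ideal D b hb
  rw [← e.summable_iff]
  refine (summable_exp_neg_posDef (posDef_gramMatrix D b)).congr fun m ↦ ?_
  rw [dotProduct_gramMatrix_intVec, Function.comp_apply, he]

/-- The **Riemann–Roch theorem** for Arakelov divisors: the theta transformation formula for the
lattice of `D`, whose dual is the lattice of `κ - D`. -/
theorem k0_eq_mul_k0_canonicalDivisor_sub (D : Divisor F) :
    k0 D = norm D / √|(discr F : ℝ)| * k0 (canonicalDivisor F - D) := by
  obtain ⟨b, hb, hdisc⟩ := exists_basis_ideal D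
  obtain ⟨e, he⟩ := exists_equiv_ideal D b hb
  have hb' (x : F) : x ∈ Submodule.span ℤ (Set.range b.traceDual) ↔
      x ∈ ideal (canonicalDivisor F - D) := by
    have h := Submodule.traceDual_span_of_basis ℤ (ideal D : Submodule (𝓞 F) F) b (by
      ext x; exact (hb x).symm)
    rw [← h, ideal_canonicalDivisor_sub, ← FractionalIdeal.mem_coe,
      FractionalIdeal.coe_dual ℤ ℚ (ideal_ne_zero D)]
    rfl
  obtain ⟨e', he'⟩ := exists_equiv_ideal (canonicalDivisor F - D) b.traceDual hb'
  have h := tsum_exp_neg_posDef (posDef_gramMatrix D b)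
  simp_rw [gramMatrix_inv, dotProduct_gramMatrix_intVec, ← he, ← he'] at h
  rw [e.tsum_eq (fun f ↦ Real.exp (-Real.pi * normSq D f)),
    e'.tsum_eq (fun f ↦ Real.exp (-Real.pi * normSq (canonicalDivisor F - D) f))] at h
  rw [k0, h, det_gramMatrix, k0, hdisc, norm_eq_exp_div_absNorm]
  congr 1
  have hN := absNorm_ideal_pos D
  push_cast
  rw [abs_mul, abs_of_pos (pow_pos hN 2), mul_assoc, Real.sqrt_mul (by positivity),
    Real.sqrt_sq hN.le, Real.sqrt_mul (abs_nonneg _), ← Real.exp_half]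
  rw [show (-2 * ∑ σ, D.2 σ) / 2 = -∑ σ, D.2 σ by ring]
  rw [Real.exp_neg]
  field_simp

end RiemannRoch

/-! ### Analyticity of Laplace transforms -/

section ExponentialIntegrals

variable {X : Type*} [MeasurableSpace X] {μ : Measure X}
  {E : Type*} [NormedAddCommGroup E] [NormedSpace ℂ E]

/-- The term of degree `n` of the power series of `z ↦ w exp (L z)`. -/
noncomputable def expTerm (n : ℕ) (w : ℂ) (L : E →L[ℂ] ℂ) :
    ContinuousMultilinearMap ℂ (fun _ : Fin n ↦ E) ℂ :=
  (w / n.factorial) • (ContinuousMultilinearMap.mkPiAlgebraFin ℂ n ℂ).compContinuousLinearMap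
    fun _ ↦ L

lemma expTerm_apply (n : ℕ) (w : ℂ) (L : E →L[ℂ] ℂ) (z : E) :
    expTerm n w L (fun _ ↦ z) = w * ((n.factorial : ℂ)⁻¹ * L z ^ n) := by
  simp [expTerm, div_eq_mul_inv, mul_assoc]

lemma norm_expTerm_le (n : ℕ) (w : ℂ) (L : E →L[ℂ] ℂ) :
    ‖expTerm n w L‖ ≤ ‖w‖ * (‖L‖ ^ n / n.factorial) := by
  have h := ContinuousMultilinearMap.norm_compContinuousLinearMap_le
    (ContinuousMultilinearMap.mkPiAlgebraFin ℂ n ℂ) (fun _ ↦ L)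
  rw [ContinuousMultilinearMap.norm_mkPiAlgebraFin, one_mul, Finset.prod_const, Finset.card_univ,
    Fintype.card_fin] at h
  rw [expTerm, norm_smul, norm_div, Complex.norm_natCast, div_mul_eq_mul_div, mul_div_assoc]
  gcongr

lemma continuous_expTerm (n : ℕ) :
    Continuous fun q : ℂ × (E →L[ℂ] ℂ) ↦ expTerm n q.1 q.2 := by
  have h : Continuous fun L : E →L[ℂ] ℂ ↦
      (ContinuousMultilinearMap.mkPiAlgebraFin ℂ n ℂ).compContinuousLinearMap fun _ ↦ L := by
    have h1 := (ContinuousMultilinearMap.compContinuousLinearMapContinuousMultilinear ℂ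
      (fun _ : Fin n ↦ E) (fun _ : Fin n ↦ ℂ) ℂ).cont
    let h2 := ContinuousLinearMap.apply ℂ (ContinuousMultilinearMap ℂ (fun _ : Fin n ↦ E) ℂ)
      (ContinuousMultilinearMap.mkPiAlgebraFin ℂ n ℂ)
    exact (h2.continuous.comp h1).comp (continuous_pi fun _ ↦ continuous_id)
  unfold expTerm
  exact (continuous_fst.div_const _).smul (h.comp continuous_snd)

/-- The Laplace transform of a rapidly decreasing weight is analytic at the origin: its power series
is obtained by integrating the exponential series term by term. -/
lemma analyticAt_zero_integral_exp {w : X → ℂ} {L : X → E →L[ℂ] ℂ}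
    (hw : AEStronglyMeasurable w μ) (hL : AEStronglyMeasurable L μ)
    (h : Integrable (fun x ↦ ‖w x‖ * Real.exp ‖L x‖) μ) :
    AnalyticAt ℂ (fun z ↦ ∫ x, w x * Complex.exp (L x z) ∂μ) 0 := by
  have hpow (n : ℕ) (x : X) : ‖L x‖ ^ n / n.factorial ≤ Real.exp ‖L x‖ :=
    Real.pow_div_factorial_le_exp _ (norm_nonneg _) n
  have hmeas (n : ℕ) : AEStronglyMeasurable (fun x ↦ expTerm n (w x) (L x)) μ :=
    (continuous_expTerm n).comp_aestronglyMeasurable (hw.prodMk hL)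
  have hint (n : ℕ) : Integrable (fun x ↦ expTerm n (w x) (L x)) μ :=
    h.mono' (hmeas n) (.of_forall fun x ↦ (norm_expTerm_le _ _ _).trans
      (mul_le_mul_of_nonneg_left (hpow n x) (norm_nonneg _)))
  let p : FormalMultilinearSeries ℂ E ℂ := fun n ↦ ∫ x, expTerm n (w x) (L x) ∂μ
  refine ⟨p, 1, ?_, one_pos, fun {y} hy ↦ ?_⟩
  · refine p.le_radius_of_bound (r := 1) (∫ x, ‖w x‖ * Real.exp ‖L x‖ ∂μ) fun n ↦ ?_
    rw [NNReal.coe_one, one_pow, mul_one]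
    exact norm_integral_le_of_norm_le h (.of_forall fun x ↦ (norm_expTerm_le _ _ _).trans
      (mul_le_mul_of_nonneg_left (hpow n x) (norm_nonneg _)))
  · have hy1 : ‖y‖ ≤ 1 := by
      have : y ∈ Metric.ball (0 : E) 1 := by simpa [← Metric.eball_ofReal] using hy
      exact (mem_ball_zero_iff.mp this).le
    have hLy (x : X) : ‖L x y‖ ≤ ‖L x‖ :=
      ((L x).le_opNorm y).trans (mul_le_of_le_one_right (norm_nonneg _) hy1)
    simp only [p, zero_add]
    simp_rw [fun n ↦ ContinuousMultilinearMap.integral_apply (hint n) (fun _ ↦ y), expTerm_apply]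
    refine hasSum_integral_of_dominated_convergence
      (fun n x ↦ ‖w x‖ * (‖L x‖ ^ n / n.factorial)) (fun n ↦ ?_) (fun n ↦ .of_forall fun x ↦ ?_)
      (.of_forall fun x ↦ ?_) ?_ (.of_forall fun x ↦ ?_)
    · have h1 : AEStronglyMeasurable (fun x ↦ L x y) μ :=
        (ContinuousLinearMap.apply ℂ ℂ y).continuous.comp_aestronglyMeasurable hL
      exact hw.mul (aestronglyMeasurable_const.mul (h1.pow n))
    · rw [norm_mul, norm_mul, norm_inv, Complex.norm_natCast, norm_pow, inv_mul_eq_div]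
      gcongr
      exact hLy x
    · exact (Real.summable_pow_div_factorial _).mul_left _
    · refine h.congr (.of_forall fun x ↦ ?_)
      simp only [tsum_mul_left]
      rw [Real.exp_eq_exp_ℝ, NormedSpace.exp_eq_tsum_div]
    · refine HasSum.mul_left _ ?_
      have := NormedSpace.expSeries_div_hasSum_exp (L x y)
      rw [← Complex.exp_eq_exp_ℂ] at this
      simpa [div_eq_inv_mul] using this

/-- Analyticity at other points follows by absorbing `exp (L z₀)` into the weight. -/
lemma analyticAt_integral_exp {w : X → ℂ} {L : X → E →L[ℂ] ℂ}
    (hw : AEStronglyMeasurable w μ) (hL : AEStronglyMeasurable L μ)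
    (h : ∀ R : ℝ, Integrable (fun x ↦ ‖w x‖ * Real.exp (R * ‖L x‖)) μ) (z₀ : E) :
    AnalyticAt ℂ (fun z ↦ ∫ x, w x * Complex.exp (L x z) ∂μ) z₀ := by
  have hLz : AEStronglyMeasurable (fun x ↦ L x z₀) μ :=
    (ContinuousLinearMap.apply ℂ ℂ z₀).continuous.comp_aestronglyMeasurable hL
  have hw' : AEStronglyMeasurable (fun x ↦ w x * Complex.exp (L x z₀)) μ :=
    hw.mul (Complex.continuous_exp.comp_aestronglyMeasurable hLz)
  have h0 := analyticAt_zero_integral_exp hw' hL <| by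
    refine (h (‖z₀‖ + 1)).mono' (hw'.norm.mul
      (Real.continuous_exp.comp_aestronglyMeasurable hL.norm)) (.of_forall fun x ↦ ?_)
    rw [norm_mul, norm_norm, Real.norm_of_nonneg (Real.exp_pos _).le, norm_mul, Complex.norm_exp,
      mul_assoc, ← Real.exp_add]
    refine mul_le_mul_of_nonneg_left (Real.exp_le_exp.mpr ?_) (norm_nonneg _)
    have := (Complex.re_le_norm (L x z₀)).trans ((L x).le_opNorm z₀)
    nlinarith
  have h1 : AnalyticAt ℂ (fun z : E ↦ z - z₀) z₀ := analyticAt_id.sub analyticAt_const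
  rw [← sub_self z₀] at h0
  refine (h0.comp_of_eq h1 rfl).congr (.of_forall fun z ↦ ?_)
  refine integral_congr_ae (.of_forall fun x ↦ ?_)
  simp only [map_sub]
  rw [mul_assoc, ← Complex.exp_add, add_sub_cancel]

end ExponentialIntegrals

/-! ### Continuation of the two-variable integral -/

section TwoVariable

variable {X : Type*} [MeasurableSpace X]

/-- The integral `∫ (exp (u a) - 1) exp (t b)` is an entire function of two variables: it is `u`
times the Laplace transform of the weight `a` on `X × [0, 1]` at `(u a θ, t b)`. -/
lemma analyticAt_integral_exp_sub_one {μ : Measure X} [SFinite μ] {a b : X → ℝ}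
    (ha : Measurable a) (hb : Measurable b) (ha0 : ∀ x, 0 ≤ a x)
    (h : ∀ R : ℝ, Integrable (fun x ↦ a x * Real.exp (R * (a x + |b x|))) μ) (p : ℂ × ℂ) :
    AnalyticAt ℂ (fun q : ℂ × ℂ ↦
      ∫ x, (Complex.exp (q.1 * a x) - 1) * Complex.exp (q.2 * b x) ∂μ) p := by
  let ν : Measure ℝ := volume.restrict (Set.Ioc 0 1)
  let L : X × ℝ → ℂ × ℂ →L[ℂ] ℂ := fun y ↦
    ((a y.1 * y.2 : ℝ) : ℂ) • ContinuousLinearMap.fst ℂ ℂ ℂ +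
      ((b y.1 : ℝ) : ℂ) • ContinuousLinearMap.snd ℂ ℂ ℂ
  have hLapply (y : X × ℝ) (q : ℂ × ℂ) : L y q = (a y.1 * y.2 : ℝ) * q.1 + b y.1 * q.2 := by
    simp [L]
  have hL : AEStronglyMeasurable L (μ.prod ν) := by
    refine Measurable.aestronglyMeasurable ?_
    fun_prop
  have hLnorm (y : X × ℝ) (hy : y.2 ∈ Set.Ioc (0 : ℝ) 1) : ‖L y‖ ≤ a y.1 + |b y.1| := by
    refine (norm_add_le _ _).trans (add_le_add ?_ ?_)
    · rw [norm_smul, Complex.norm_real, Real.norm_of_nonneg (mul_nonneg (ha0 _) hy.1.le)]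
      calc a y.1 * y.2 * ‖ContinuousLinearMap.fst ℂ ℂ ℂ‖ ≤ a y.1 * 1 * 1 := by
            have := ha0 y.1
            gcongr
            · exact hy.2
            · exact ContinuousLinearMap.norm_fst_le ℂ ℂ ℂ
        _ = a y.1 := by ring
    · rw [norm_smul, Complex.norm_real, Real.norm_eq_abs]
      exact mul_le_of_le_one_right (abs_nonneg _) (ContinuousLinearMap.norm_snd_le ℂ ℂ ℂ)
  have hae : ∀ᵐ y ∂μ.prod ν, y.2 ∈ Set.Ioc (0 : ℝ) 1 :=
    Measure.quasiMeasurePreserving_snd.ae (ae_restrict_mem measurableSet_Ioc)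
  have hw : AEStronglyMeasurable (fun y : X × ℝ ↦ (a y.1 : ℂ)) (μ.prod ν) :=
    Measurable.aestronglyMeasurable (by fun_prop)
  have hR (R : ℝ) : Integrable (fun y ↦ ‖(a y.1 : ℂ)‖ * Real.exp (R * ‖L y‖)) (μ.prod ν) := by
    refine ((h |R|).comp_fst ν).mono' (hw.norm.mul
      (Real.continuous_exp.comp_aestronglyMeasurable (hL.norm.const_mul R))) ?_
    filter_upwards [hae] with y hy
    rw [norm_mul, norm_norm, Complex.norm_real, Real.norm_of_nonneg (ha0 _),
      Real.norm_of_nonneg (Real.exp_pos _).le]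
    refine mul_le_mul_of_nonneg_left (Real.exp_le_exp.mpr ?_) (ha0 _)
    exact (mul_le_mul_of_nonneg_right (le_abs_self R) (norm_nonneg _)).trans
      (mul_le_mul_of_nonneg_left (hLnorm y hy) (abs_nonneg R))
  have hA := (analyticAt_fst (𝕜 := ℂ) (p := p)).mul (analyticAt_integral_exp hw hL hR p)
  refine hA.congr (.of_forall fun q ↦ ?_)
  have hint : Integrable (fun y ↦ (a y.1 : ℂ) * Complex.exp (L y q)) (μ.prod ν) := by
    have hLq : AEStronglyMeasurable (fun y ↦ L y q) (μ.prod ν) :=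
      (ContinuousLinearMap.apply ℂ ℂ q).continuous.comp_aestronglyMeasurable hL
    refine (hR ‖q‖).mono' (hw.mul (Complex.continuous_exp.comp_aestronglyMeasurable hLq))
      (.of_forall fun y ↦ ?_)
    rw [norm_mul, Complex.norm_exp]
    refine mul_le_mul_of_nonneg_left (Real.exp_le_exp.mpr ?_) (norm_nonneg _)
    rw [mul_comm]
    exact (Complex.re_le_norm _).trans ((L y).le_opNorm q)
  simp only [Pi.mul_apply]
  rw [integral_prod _ hint, ← integral_const_mul]
  refine integral_congr_ae (.of_forall fun x ↦ ?_)
  simp only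
  have hderiv (θ : ℝ) : HasDerivAt
      (fun θ : ℝ ↦ Complex.exp (q.1 * a x * θ) * Complex.exp (q.2 * b x))
      (q.1 * (a x * Complex.exp (L (x, θ) q))) θ := by
    have h1 : HasDerivAt (fun θ : ℝ ↦ q.1 * a x * (θ : ℂ)) (q.1 * a x) θ := by
      simpa using (Complex.ofRealCLM.hasDerivAt (x := θ)).const_mul (q.1 * a x)
    convert! h1.cexp.mul_const (Complex.exp (q.2 * b x)) using 1
    rw [hLapply]
    push_cast
    rw [show (a x : ℂ) * θ * q.1 + b x * q.2 = q.1 * a x * θ + q.2 * b x by ring, Complex.exp_add]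
    ring
  have hcont : Continuous fun θ : ℝ ↦ q.1 * (a x * Complex.exp (L (x, θ) q)) := by
    simp_rw [hLapply]
    fun_prop
  have := intervalIntegral.integral_eq_sub_of_hasDerivAt (a := 0) (b := 1)
    (fun θ _ ↦ hderiv θ) (hcont.intervalIntegrable 0 1)
  rw [intervalIntegral.integral_of_le zero_le_one, integral_const_mul] at this
  rw [this]
  simp
  ring

variable {ν : Measure X} {a b : X → ℝ}

/-- If `ρ` preserves `ν` and changes the sign of `b`, then `ν` is the sum of its
restriction to `{b > 0}` and of the image of this restriction under `ρ`. -/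
lemma eq_restrict_add_map {ρ : X → X} (hρ : MeasurePreserving ρ ν ν) (hb : Measurable b)
    (hbρ : ∀ x, b (ρ x) = -b x) (h0 : ν {x | b x = 0} = 0) :
    ν = ν.restrict {x | 0 < b x} + (ν.restrict {x | 0 < b x}).map ρ := by
  have hpos : MeasurableSet {x | 0 < b x} := measurableSet_lt measurable_const hb
  have hneg : MeasurableSet {x | b x < 0} := measurableSet_lt hb measurable_const
  have h1 : (ν.restrict {x | 0 < b x}).map ρ = ν.restrict {x | b x < 0} := by
    have h := Measure.restrict_map (μ := ν) hρ.measurable hneg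
    rw [hρ.map_eq] at h
    rw [h]
    congr 2
    ext x
    simp [hbρ]
  have h2 : ν.restrict {x | 0 < b x}ᶜ = ν.restrict {x | b x < 0} := by
    refine Measure.restrict_congr_set ?_
    have : ∀ᵐ x ∂ν, b x ≠ 0 := by rw [ae_iff]; simpa using h0
    filter_upwards [this] with x hx
    exact propext ⟨fun h ↦ lt_of_le_of_ne (not_lt.mp h) hx, fun h ↦ not_lt.mpr (le_of_lt h)⟩
  rw [h1, ← h2, Measure.restrict_add_restrict_compl hpos]

lemma map_restrict_pos (hb : Measurable b) {V : NNReal} (hV : ν.map b = V • volume) :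
    (ν.restrict {x | 0 < b x}).map b = V • volume.restrict (Set.Ioi 0) := by
  have h := Measure.restrict_map (μ := ν) hb (measurableSet_Ioi (a := (0 : ℝ)))
  rw [hV, Measure.restrict_smul] at h
  exact h.symm

lemma integrable_exp_of_map (hb : Measurable b) {V : NNReal} (hV : ν.map b = V • volume) {z : ℂ}
    (hz : z.re < 0) : Integrable (fun x ↦ Complex.exp (z * b x)) (ν.restrict {x | 0 < b x}) := by
  have h := (integrableOn_exp_mul_complex_Ioi hz 0)
  refine Integrable.comp_measurable (g := fun y : ℝ ↦ Complex.exp (z * y)) ?_ hb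
  rw [map_restrict_pos hb hV]
  exact h.smul_measure_nnreal

lemma integral_exp_of_map (hb : Measurable b) {V : NNReal} (hV : ν.map b = V • volume) {z : ℂ}
    (hz : z.re < 0) : ∫ x in {x | 0 < b x}, Complex.exp (z * b x) ∂ν = -V / z := by
  have h := integral_map (μ := ν.restrict {x | 0 < b x}) hb.aemeasurable
    (f := fun y : ℝ ↦ Complex.exp (z * y)) (Continuous.aestronglyMeasurable (by fun_prop))
  rw [← h, map_restrict_pos hb hV, integral_smul_nnreal_measure, integral_exp_mul_complex_Ioi hz]
  simp [NNReal.smul_def]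
  ring

/-- The continuation of the two-variable zeta integral, for a measure space with functions
`a = h⁰`, `b = h¹ - h⁰` and a symmetry `ρ` that exchanges `h⁰` and `h¹`. The function `H` is the
entire part: all poles come from the integrals of exponentials of `b`. -/
theorem exists_twoVariable_continuation [SFinite ν] {ρ : X → X} (ha : Measurable a)
    (hb : Measurable b) (ha0 : ∀ x, 0 ≤ a x) (hρ : MeasurePreserving ρ ν ν)
    (haρ : ∀ x, a (ρ x) = a x + b x) (hbρ : ∀ x, b (ρ x) = -b x) {V : NNReal}
    (hV : ν.map b = V • volume) (hbdd : ∃ A, ∀ x, 0 ≤ b x → a x ≤ A)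
    (hint : ∀ c : ℝ, 1 < c →
      Integrable (fun x ↦ (Real.exp (a x) - 1) * Real.exp (c * b x)) ν) :
    (∀ s t : ℂ, s.re < 0 → t.re < 0 →
      Integrable (fun x ↦ Complex.exp (s * a x + t * (a x + b x : ℝ))) ν) ∧
    ∃ H : ℂ × ℂ → ℂ, (∀ p, AnalyticAt ℂ H p) ∧
      (∀ s t : ℂ, s.re < 0 → t.re < 0 →
        ∫ x, Complex.exp (s * a x + t * (a x + b x : ℝ)) ∂ν = H (s, t) - V / s - V / t) ∧
      ∀ s : ℂ, 1 < s.re →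
        ∫ x, ((Real.exp (a x) - 1 : ℝ) : ℂ) * Complex.exp (s * b x) ∂ν =
          H (s, 1 - s) - V / s - V / (1 - s) := by
  set μ := ν.restrict {x | 0 < b x} with hμ
  have h0 : ν {x | b x = 0} = 0 := by
    have := congrArg (fun m ↦ m {(0 : ℝ)}) hV
    simp only [Measure.smul_apply, Real.volume_singleton, smul_zero] at this
    rwa [Measure.map_apply hb (measurableSet_singleton 0)] at this
  have hsum : ν = μ + μ.map ρ := eq_restrict_add_map hρ hb hbρ h0
  have hinteg {g : X → ℂ} (hg : Measurable g) :
      Integrable g ν ↔ Integrable g μ ∧ Integrable (fun x ↦ g (ρ x)) μ := by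
    rw [hsum, integrable_add_measure,
      integrable_map_measure hg.aestronglyMeasurable hρ.measurable.aemeasurable]
    rfl
  have hintegral {g : X → ℂ} (hg : Measurable g) (hgi : Integrable g ν) :
      ∫ x, g x ∂ν = ∫ x, g x ∂μ + ∫ x, g (ρ x) ∂μ := by
    obtain ⟨h1, h2⟩ := (hinteg hg).mp hgi
    conv_lhs => rw [hsum]
    rw [integral_add_measure h1 ((integrable_map_measure hg.aestronglyMeasurable
      hρ.measurable.aemeasurable).mpr h2), integral_map hρ.measurable.aemeasurable
      hg.aestronglyMeasurable]
  have hbpos : ∀ᵐ x ∂μ, 0 < b x := ae_restrict_mem (measurableSet_lt measurable_const hb)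
  obtain ⟨A, hA⟩ := hbdd
  -- on the half space `{b > 0}` the function `a` decays faster than any exponential of `b`
  have hdecay (R : ℝ) : Integrable (fun x ↦ a x * Real.exp (R * (a x + |b x|))) μ := by
    have h := ((hint (|R| + 2) (by linarith [abs_nonneg R])).mono_measure
      (Measure.restrict_le_self (s := {x | 0 < b x}))).const_mul (Real.exp (|R| * A))
    refine h.mono' (Measurable.aestronglyMeasurable (by fun_prop)) ?_
    filter_upwards [hbpos] with x hx
    rw [norm_mul, Real.norm_of_nonneg (ha0 x), Real.norm_of_nonneg (Real.exp_pos _).le,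
      mul_left_comm, ← Real.exp_add]
    refine mul_le_mul (by linarith [Real.add_one_le_exp (a x)]) (Real.exp_le_exp.mpr ?_)
      (Real.exp_pos _).le (by linarith [Real.add_one_le_exp (a x), ha0 x])
    rw [abs_of_pos hx]
    have h1 := mul_le_mul_of_nonneg_right (le_abs_self R) (add_nonneg (ha0 x) hx.le)
    have h2 := mul_le_mul_of_nonneg_left (hA x hx.le) (abs_nonneg R)
    nlinarith
  set G : ℂ × ℂ → ℂ := fun q ↦ ∫ x, (Complex.exp (q.1 * a x) - 1) * Complex.exp (q.2 * b x) ∂μ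
    with hG
  have hGan (p : ℂ × ℂ) : AnalyticAt ℂ G p := analyticAt_integral_exp_sub_one ha hb ha0 hdecay p
  have hexp {z : ℂ} (hz : z.re < 0) : Integrable (fun x ↦ Complex.exp (z * b x)) μ :=
    integrable_exp_of_map hb hV hz
  have hexpI {z : ℂ} (hz : z.re < 0) : ∫ x, Complex.exp (z * b x) ∂μ = -V / z :=
    integral_exp_of_map hb hV hz
  -- the integral over one half space
  have hhalf (s t : ℂ) (hs : s.re < 0) (ht : t.re < 0) :
      Integrable (fun x ↦ Complex.exp ((s + t) * a x + t * b x)) μ := by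
    refine (hexp ht).mono (Measurable.aestronglyMeasurable (by fun_prop)) (.of_forall fun x ↦ ?_)
    rw [Complex.norm_exp, Complex.norm_exp, Real.exp_le_exp]
    have h1 : (s.re + t.re) * a x ≤ 0 := mul_nonpos_of_nonpos_of_nonneg (by linarith) (ha0 x)
    simpa using h1
  have hhalfI (s t : ℂ) (hs : s.re < 0) (ht : t.re < 0) :
      ∫ x, Complex.exp ((s + t) * a x + t * b x) ∂μ = G (s + t, t) - V / t := by
    have h1 : (fun x ↦ (Complex.exp ((s + t) * a x) - 1) * Complex.exp (t * b x)) =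
        fun x ↦ Complex.exp ((s + t) * a x + t * b x) - Complex.exp (t * b x) := by
      ext x
      rw [sub_mul, one_mul, ← Complex.exp_add]
    rw [hG]
    simp only [h1]
    rw [integral_sub (hhalf s t hs ht) (hexp ht), hexpI ht]
    ring
  have hreflect (s t : ℂ) (x : X) : s * a (ρ x) + t * (a (ρ x) + b (ρ x) : ℝ) =
      (t + s) * a x + s * b x := by
    rw [haρ, hbρ]; push_cast; ring
  have hself (s t : ℂ) (x : X) : s * a x + t * (a x + b x : ℝ) =
      (s + t) * a x + t * b x := by
    push_cast; ring
  have hmeas (s t : ℂ) : Measurable fun x ↦ Complex.exp (s * a x + t * (a x + b x : ℝ)) := by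
    fun_prop
  have hI (s t : ℂ) (hs : s.re < 0) (ht : t.re < 0) :
      Integrable (fun x ↦ Complex.exp (s * a x + t * (a x + b x : ℝ))) ν := by
    rw [hinteg (hmeas s t)]
    simp only [hreflect]
    simp only [hself]
    exact ⟨hhalf s t hs ht, hhalf t s ht hs⟩
  refine ⟨hI, fun q ↦ G (q.1 + q.2, q.2) + G (q.1 + q.2, q.1), fun p ↦ ?_, fun s t hs ht ↦ ?_,
    fun s hs ↦ ?_⟩
  · have h1 : AnalyticAt ℂ (fun q : ℂ × ℂ ↦ q.1 + q.2) p := analyticAt_fst.add analyticAt_snd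
    exact ((hGan _).comp (h1.prod analyticAt_snd)).add ((hGan _).comp (h1.prod analyticAt_fst))
  · rw [hintegral (hmeas s t) (hI s t hs ht)]
    simp only [hreflect]
    simp only [hself]
    rw [hhalfI s t hs ht, hhalfI t s ht hs, add_comm t s]
    ring
  · have hs' : (1 - s).re < 0 := by simpa using hs
    have hs'' : (-s).re < 0 := by simp; linarith
    set g : X → ℂ := fun x ↦ ((Real.exp (a x) - 1 : ℝ) : ℂ) * Complex.exp (s * b x) with hg
    have hgm : Measurable g := by fun_prop
    have hgi : Integrable g ν := by
      refine (hint s.re hs).mono' hgm.aestronglyMeasurable (.of_forall fun x ↦ ?_)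
      rw [norm_mul, Complex.norm_real, Complex.norm_exp, Real.norm_of_nonneg
        (by linarith [Real.add_one_le_exp (a x), ha0 x])]
      simp
    have hg1 (x : X) : g x = (Complex.exp ((1 : ℂ) * a x) - 1) * Complex.exp (s * b x) := by
      simp [hg]
    have hg2 (x : X) : g (ρ x) = (Complex.exp ((1 : ℂ) * a x) - 1) * Complex.exp ((1 - s) * b x) +
        (Complex.exp ((1 - s) * b x) - Complex.exp (-s * b x)) := by
      simp only [hg, haρ, hbρ]
      push_cast
      rw [sub_mul, sub_mul, ← Complex.exp_add, ← Complex.exp_add,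
        show (a x + b x : ℂ) + s * -b x = 1 * a x + (1 - s) * b x by ring,
        show s * -(b x : ℂ) = -s * b x by ring]
      ring
    -- the two pieces of `g ∘ ρ` are integrable separately
    have hg2i := ((hinteg hgm).mp hgi).2
    have hd : Integrable (fun x ↦ Complex.exp ((1 - s) * b x) - Complex.exp (-s * b x)) μ :=
      (hexp hs').sub (hexp hs'')
    have hg3i : Integrable (fun x ↦ (Complex.exp ((1 : ℂ) * a x) - 1) *
        Complex.exp ((1 - s) * b x)) μ := by
      refine (hg2i.sub hd).congr (.of_forall fun x ↦ ?_)
      simp only [Pi.sub_apply, hg2]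
      ring
    rw [hintegral hgm hgi]
    simp only [hg2]
    simp only [hg1]
    rw [integral_add hg3i hd]
    rw [integral_sub (hexp hs') (hexp hs''), hexpI hs', hexpI hs'', hG]
    simp only [add_sub_cancel]
    ring

end TwoVariable

/-! ### The measure on the Arakelov class group -/

section PicMeasure
variable {F : Type*} [Field F] [NumberField F]

variable (F) in
lemma countable_numberField : Countable F :=
  (Module.finBasis ℚ F).equivFun.toEquiv.countable_iff.mpr inferInstance

instance countable_heightOneSpectrum : Countable (HeightOneSpectrum (𝓞 F)) := by
  have := countable_numberField F
  have h1 : Countable (𝓞 F) := RingOfIntegers.coe_injective.countable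
  have h2 : Countable (Ideal (𝓞 F)) := by
    refine Function.Surjective.countable (f := fun s : Finset (𝓞 F) ↦ Ideal.span (s : Set (𝓞 F)))
      fun I ↦ ?_
    obtain ⟨s, hs⟩ := IsNoetherian.noetherian I
    exact ⟨s, hs⟩
  exact Function.Injective.countable (f := HeightOneSpectrum.asIdeal) fun _ _ h ↦
    HeightOneSpectrum.ext h

instance countable_principal_range : Countable (principal F).range := by
  have := countable_numberField F
  have : Countable (Additive Fˣ) := (Units.val_injective (α := F)).countable
  exact (principal F).rangeRestrict_surjective.countable

instance measurableAdd₂_finitePart : MeasurableAdd₂ (HeightOneSpectrum (𝓞 F) →₀ ℤ) :=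
  ⟨.of_discrete⟩

instance measurableNeg_finitePart : MeasurableNeg (HeightOneSpectrum (𝓞 F) →₀ ℤ) :=
  ⟨.of_discrete⟩

instance sFinite_divMeasure : SFinite (divMeasure F) := by
  unfold divMeasure; infer_instance

instance isAddLeftInvariant_divMeasure : (divMeasure F).IsAddLeftInvariant := by
  unfold divMeasure; infer_instance

instance measurableAdd₂_divisor : MeasurableAdd₂ (Divisor F) :=
  ⟨((measurable_fst.comp measurable_fst).add (measurable_fst.comp measurable_snd)).prodMk
    ((measurable_snd.comp measurable_fst).add (measurable_snd.comp measurable_snd))⟩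

instance measurableNeg_divisor : MeasurableNeg (Divisor F) :=
  ⟨measurable_fst.neg.prodMk measurable_snd.neg⟩

instance isNegInvariant_divMeasure : (divMeasure F).IsNegInvariant := by
  have h := (Measure.measurePreserving_neg
    (Measure.count : Measure (HeightOneSpectrum (𝓞 F) →₀ ℤ))).prod
    (Measure.measurePreserving_neg (volume : Measure (InfinitePlace F → ℝ)))
  exact ⟨h.map_eq⟩

instance measurableConstVAdd_principal : MeasurableConstVAdd (principal F).range (Divisor F) :=
  ⟨fun γ ↦ measurable_const_add (γ : Divisor F)⟩

lemma measurable_mk : Measurable (QuotientAddGroup.mk : Divisor F → Pic F) :=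
  measurable_quotient_mk''

lemma measurable_pic_iff {β : Type*} [MeasurableSpace β] {f : Pic F → β} :
    Measurable f ↔ Measurable fun D : Divisor F ↦ f D := measurable_from_quotient

lemma measurable_of_slices {β : Type*} [MeasurableSpace β] {f : Divisor F → β}
    (hf : ∀ x, Measurable fun y ↦ f (x, y)) : Measurable f :=
  measurable_from_prod_countable_right hf

/-- The box of side `ε` with lower corner `c` in the infinite components. -/
def box (ε : ℝ) (c : Divisor F) : Set (Divisor F) :=
  {D | D.1 = c.1 ∧ ∀ σ, D.2 σ ∈ Set.Ico (c.2 σ) (c.2 σ + ε)}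

lemma box_eq_prod (ε : ℝ) (c : Divisor F) :
    box ε c = {c.1} ×ˢ Set.univ.pi fun σ ↦ Set.Ico (c.2 σ) (c.2 σ + ε) := by
  ext D
  simp [box]

lemma measurableSet_box (ε : ℝ) (c : Divisor F) : MeasurableSet (box ε c) := by
  rw [box_eq_prod]
  exact (measurableSet_singleton _).prod (.univ_pi fun _ ↦ measurableSet_Ico)

lemma divMeasure_box (ε : ℝ) (c : Divisor F) :
    divMeasure F (box ε c) = ENNReal.ofReal ε ^ Fintype.card (InfinitePlace F) := by
  rw [box_eq_prod, divMeasure, Measure.prod_prod, Measure.count_singleton, one_mul, volume_pi_pi]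
  simp

lemma idealDivisor_eq_zero_iff {I : FractionalIdeal (𝓞 F)⁰ F} (hI : I ≠ 0)
    (h : idealDivisor I = 0) : I = 1 := by
  have h1 := ideal_idealDivisor hI
  rw [h, Finsupp.prod_zero_index] at h1
  rw [← inv_inv I, ← h1, inv_one]

/-- The elements whose principal divisor has no finite part are integral, and in fact units. -/
lemma isIntegral_of_principal_fst_eq_zero {g : Additive Fˣ} (h : (principal F g).1 = 0) :
    IsIntegral ℤ (g.toMul : F) := by
  have h1 := idealDivisor_eq_zero_iff (span_ne_zero g.toMul) h
  have h2 : (g.toMul : F) ∈ FractionalIdeal.spanSingleton (𝓞 F)⁰ (g.toMul : F) :=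
    FractionalIdeal.mem_spanSingleton_self _ _
  rw [h1, FractionalIdeal.mem_one_iff] at h2
  obtain ⟨x, hx⟩ := h2
  rw [← hx]
  exact x.2

variable (F) in
/-- The group of principal divisors is discrete: only finitely many algebraic integers in `F` have
bounded absolute values, so that finitely many nonzero principal divisors without finite part have
bounded infinite components. -/
lemma exists_principal_eq_zero : ∃ ε > 0, ∀ g : Additive Fˣ, (principal F g).1 = 0 →
    (∀ σ, |(principal F g).2 σ| < ε) → principal F g = 0 := by
  let T : Set (InfinitePlace F → ℝ) := {y | y ≠ 0 ∧ (∀ σ, |y σ| ≤ 1) ∧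
    ∃ g, (principal F g).1 = 0 ∧ (principal F g).2 = y}
  have hT : T.Finite := by
    have hfin := Embeddings.finite_of_norm_le F ℂ (Real.exp 1)
    refine (hfin.image fun x ↦ fun σ : InfinitePlace F ↦ -(σ.mult * Real.log (σ x))).subset ?_
    rintro y ⟨-, hy, g, hg1, rfl⟩
    refine ⟨(g.toMul : F), ⟨isIntegral_of_principal_fst_eq_zero hg1, fun φ ↦ ?_⟩, rfl⟩
    set σ := InfinitePlace.mk φ
    have hpos : 0 < σ (g.toMul : F) := by simp [InfinitePlace.pos_iff]
    have h1 : |-(σ.mult * Real.log (σ (g.toMul : F)))| ≤ 1 := hy σ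
    rw [abs_neg, abs_mul] at h1
    have h2 : (1 : ℝ) ≤ |(σ.mult : ℝ)| := by
      rw [Nat.abs_cast]; exact_mod_cast σ.mult_pos
    have h3 : |Real.log (σ (g.toMul : F))| ≤ 1 := by
      nlinarith [abs_nonneg (Real.log (σ (g.toMul : F)))]
    have h4 := Real.exp_le_exp.mpr ((le_abs_self _).trans h3)
    rwa [Real.exp_log hpos] at h4
  have h0 : (0 : InfinitePlace F → ℝ) ∈ Tᶜ := fun h ↦ h.1 rfl
  obtain ⟨ε, hε, hball⟩ := Metric.isOpen_iff.mp hT.isClosed.isOpen_compl 0 h0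
  refine ⟨min ε 1, lt_min hε one_pos, fun g hg1 hg2 ↦ ?_⟩
  by_contra hne
  refine hball (a := (principal F g).2) ?_ ⟨fun h ↦ hne (Prod.ext hg1 h), fun σ ↦ ?_, g, hg1, rfl⟩
  · rw [mem_ball_zero_iff, pi_norm_lt_iff hε]
    exact fun σ ↦ (hg2 σ).trans_le (min_le_left _ _)
  · exact ((hg2 σ).trans_le (min_le_right _ _)).le

variable (F) in
/-- Small boxes inject into `Pic(F)`. -/
lemma exists_injOn_box : ∃ ε > 0, ∀ c : Divisor F,
    (box ε c).InjOn (QuotientAddGroup.mk : Divisor F → Pic F) := by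
  obtain ⟨ε, hε, h⟩ := exists_principal_eq_zero F
  refine ⟨ε, hε, fun c x hx y hy hxy ↦ ?_⟩
  obtain ⟨g, hg⟩ := QuotientAddGroup.eq.mp hxy
  have h0 := h g (by rw [hg]; simp [hx.1, hy.1]) fun σ ↦ by
    rw [hg, abs_lt]
    obtain ⟨h1, h2⟩ := hx.2 σ
    obtain ⟨h3, h4⟩ := hy.2 σ
    constructor <;> simp <;> linarith
  rw [h0] at hg
  exact neg_add_eq_zero.mp hg.symm

lemma mk_preimage_image (U : Set (Divisor F)) :
    (QuotientAddGroup.mk : Divisor F → Pic F) ⁻¹' (QuotientAddGroup.mk '' U) =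
      ⋃ γ : (principal F).range, (fun x ↦ (γ : Divisor F) + x) ⁻¹' U := by
  rw [QuotientAddGroup.preimage_image_mk]
  ext x
  simp [add_comm]

variable (F) in
/-- There is a measurable set of representatives of the classes of divisors: cover `Div(F)` by
countably many boxes that inject into `Pic(F)`, and remove from each box the divisors that are
equivalent to one in an earlier box. -/
lemma exists_transversal : ∃ S : Set (Divisor F), MeasurableSet S ∧
    S.InjOn (QuotientAddGroup.mk : Divisor F → Pic F) ∧
    ∀ x : Divisor F, ∃ y ∈ S, (y : Pic F) = x := by
  obtain ⟨ε, hε, hinj⟩ := exists_injOn_box F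
  obtain ⟨c, hc⟩ := exists_surjective_nat
    ((HeightOneSpectrum (𝓞 F) →₀ ℤ) × (InfinitePlace F → ℤ))
  let U : ℕ → Set (Divisor F) := fun n ↦ box ε ((c n).1, fun σ ↦ (c n).2 σ * ε)
  have hU (x : Divisor F) : ∃ n, x ∈ U n := by
    obtain ⟨n, hn⟩ := hc (x.1, fun σ ↦ ⌊x.2 σ / ε⌋)
    refine ⟨n, ?_, fun σ ↦ ?_⟩
    · simp [hn]
    · have h1 := Int.floor_le (x.2 σ / ε)
      have h2 := Int.lt_floor_add_one (x.2 σ / ε)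
      rw [le_div_iff₀ hε] at h1
      rw [div_lt_iff₀ hε] at h2
      simp only [hn]
      exact ⟨h1, by linarith⟩
  let W : ℕ → Set (Divisor F) := fun n ↦
    (QuotientAddGroup.mk : Divisor F → Pic F) ⁻¹' (QuotientAddGroup.mk '' U n)
  have hW (n : ℕ) : MeasurableSet (W n) := by
    simp only [W, mk_preimage_image]
    exact .iUnion fun γ ↦ (measurable_const_add _) (measurableSet_box _ _)
  refine ⟨⋃ n, U n \ ⋃ m < n, W m, ?_, ?_, fun x ↦ ?_⟩
  · exact .iUnion fun n ↦ (measurableSet_box _ _).diff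
      (.iUnion fun m ↦ .iUnion fun _ ↦ hW m)
  · intro x hx y hy hxy
    obtain ⟨n, hxn, hxn'⟩ := Set.mem_iUnion.mp hx
    obtain ⟨m, hym, hym'⟩ := Set.mem_iUnion.mp hy
    rcases lt_trichotomy n m with h | rfl | h
    · exact (hym' (Set.mem_biUnion (show n ∈ {k | k < m} from h) ⟨x, hxn, hxy⟩)).elim
    · exact hinj _ hxn hym hxy
    · exact (hxn' (Set.mem_biUnion (show m ∈ {k | k < n} from h) ⟨y, hym, hxy.symm⟩)).elim
  · classical
    have hex : ∃ n, x ∈ W n := by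
      obtain ⟨n, hn⟩ := hU x
      exact ⟨n, x, hn, rfl⟩
    obtain ⟨y, hy, hyx⟩ := Nat.find_spec hex
    refine ⟨y, Set.mem_iUnion.mpr ⟨Nat.find hex, hy, fun hmem ↦ ?_⟩, hyx⟩
    obtain ⟨m, hm, z, hz, hzy⟩ := by simpa only [Set.mem_iUnion, exists_prop] using hmem
    exact Nat.find_min hex hm ⟨z, hz, hzy.trans hyx⟩

lemma isAddFundamentalDomain_of_transversal {S : Set (Divisor F)} (hS : MeasurableSet S)
    (hinj : S.InjOn (QuotientAddGroup.mk : Divisor F → Pic F))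
    (hsurj : ∀ x : Divisor F, ∃ y ∈ S, (y : Pic F) = x) :
    IsAddFundamentalDomain (principal F).range S (divMeasure F) := by
  refine .mk' hS.nullMeasurableSet fun x ↦ ?_
  obtain ⟨y, hy, hyx⟩ := hsurj x
  have hmem : -x + y ∈ (principal F).range := QuotientAddGroup.eq.mp hyx.symm
  refine ⟨⟨-x + y, hmem⟩, ?_, fun γ hγ ↦ ?_⟩
  · change -x + y + x ∈ S
    rwa [neg_add_cancel_comm]
  · have h1 : (γ : Divisor F) + x ∈ S := hγ
    have h2 : (((γ : Divisor F) + x : Divisor F) : Pic F) = y := by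
      rw [hyx, QuotientAddGroup.mk_add, (QuotientAddGroup.eq_zero_iff _).mpr γ.2, zero_add]
    refine Subtype.ext ?_
    change (γ : Divisor F) = -x + y
    rw [← hinj h1 hy h2]
    abel

/-- The measure on `Pic(F)` is the image of the measure of a set of representatives. The
supremum defining `picMeasure` is attained there, because any set that meets each class at most once
can be moved piecewise into a fundamental domain. -/
lemma picMeasure_eq_map {S : Set (Divisor F)} (hS : MeasurableSet S)
    (hinj : S.InjOn (QuotientAddGroup.mk : Divisor F → Pic F))
    (hsurj : ∀ x : Divisor F, ∃ y ∈ S, (y : Pic F) = x) :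
    picMeasure F = ((divMeasure F).restrict S).map QuotientAddGroup.mk := by
  have hdom := isAddFundamentalDomain_of_transversal hS hinj hsurj
  refine le_antisymm (iSup_le fun T ↦ iSup_le fun hT ↦ iSup_le fun hTinj ↦ ?_)
    (le_iSup_of_le S (le_iSup_of_le hS (le_iSup_of_le hinj le_rfl)))
  refine Measure.le_iff.mpr fun A hA ↦ ?_
  rw [Measure.map_apply measurable_mk hA, Measure.map_apply measurable_mk hA,
    Measure.restrict_apply (measurable_mk hA), Measure.restrict_apply (measurable_mk hA),
    hdom.measure_eq_tsum, ← measure_iUnion]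
  · refine measure_mono (Set.iUnion_subset fun γ ↦ ?_)
    rintro _ ⟨⟨x, hx, rfl⟩, hxS⟩
    refine ⟨?_, hxS⟩
    have : (((γ : Divisor F) + x : Divisor F) : Pic F) = x := by
      rw [QuotientAddGroup.mk_add, (QuotientAddGroup.eq_zero_iff _).mpr γ.2, zero_add]
    change (((γ : Divisor F) + x : Divisor F) : Pic F) ∈ A
    rw [this]
    exact hx.1
  · intro γ δ hne
    refine Set.disjoint_left.mpr ?_
    rintro _ ⟨⟨x, hx, rfl⟩, -⟩ ⟨⟨y, hy, hxy⟩, -⟩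
    have hxy' : (δ : Divisor F) + y = γ + x := hxy
    have h : (x : Pic F) = y := by
      refine QuotientAddGroup.eq.mpr ?_
      have : -x + y = ((γ - δ : (principal F).range) : Divisor F) := by
        rw [AddSubgroup.coe_sub]
        have : (γ : Divisor F) = δ + y - x := by rw [hxy']; abel
        rw [this]; abel
      rw [this]
      exact (γ - δ).2
    rw [hTinj hx.2 hy.2 h] at hxy'
    exact hne (Subtype.ext (add_right_cancel hxy').symm)
  · exact fun γ ↦ ((measurable_mk hA).inter hT).const_vadd γ |>.inter hS

instance sFinite_picMeasure : SFinite (picMeasure F) := by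
  obtain ⟨S, hS, hinj, hsurj⟩ := exists_transversal F
  rw [picMeasure_eq_map hS hinj hsurj]
  infer_instance

end PicMeasure

/-! ### Heights on the Arakelov class group -/

section Unfolding
variable {F : Type*} [Field F] [NumberField F]

lemma one_le_k0 (D : Divisor F) : 1 ≤ k0 D := by
  have h := (summable_k0 D).le_tsum ⟨0, FractionalIdeal.zero_mem _⟩ fun _ _ ↦ (Real.exp_pos _).le
  have h0 : normSq D 0 = 0 := by simp [normSq]
  rw [h0, mul_zero, Real.exp_zero] at h
  exact h

lemma picH0_mk (D : Divisor F) : picH0 (D : Pic F) = Real.log (k0 D) := rfl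

lemma exp_picH0_mk (D : Divisor F) : Real.exp (picH0 (D : Pic F)) = k0 D := by
  rw [picH0_mk, Real.exp_log (zero_lt_one.trans_le (one_le_k0 D))]

lemma picH0_nonneg (c : Pic F) : 0 ≤ picH0 c := by
  obtain ⟨D, rfl⟩ := QuotientAddGroup.mk_surjective c
  exact Real.log_nonneg (one_le_k0 D)

lemma picH1_nonneg (c : Pic F) : 0 ≤ picH1 c := picH0_nonneg _

/-- The difference `h¹ - h⁰` on `Pic(F)`, which by the Riemann–Roch theorem is `log √|Δ| - deg`. -/
noncomputable def defect (c : Pic F) : ℝ := picH1 c - picH0 c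

variable (F) in
lemma sqrt_discr_pos : 0 < √|(discr F : ℝ)| :=
  Real.sqrt_pos.mpr (abs_pos.mpr (by exact_mod_cast discr_ne_zero F))

lemma defect_mk (D : Divisor F) : defect (D : Pic F) = Real.log √|(discr F : ℝ)| - degree D := by
  have h := k0_eq_mul_k0_canonicalDivisor_sub D
  have h1 : picH1 (D : Pic F) = Real.log (k0 (canonicalDivisor F - D)) := rfl
  have hk := zero_lt_one.trans_le (one_le_k0 (canonicalDivisor F - D))
  have hN : 0 < norm D := Real.exp_pos _
  rw [defect, h1, picH0_mk, h, Real.log_mul (div_pos hN (sqrt_discr_pos F)).ne' hk.ne',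
    Real.log_div hN.ne' (sqrt_discr_pos F).ne', norm, Real.log_exp]
  ring

/-- The reflection `c ↦ κ - c` of `Pic(F)`. -/
noncomputable def reflect (c : Pic F) : Pic F := (canonicalDivisor F : Pic F) - c

lemma picH0_reflect (c : Pic F) : picH0 (reflect c) = picH0 c + defect c := by
  rw [defect, add_sub_cancel]; rfl

lemma defect_reflect (c : Pic F) : defect (reflect c) = -defect c := by
  have : picH1 (reflect c) = picH0 c := by rw [picH1, reflect, sub_sub_cancel]
  rw [defect, this, picH0_reflect]
  ring

/-! ### Measurability of the integrands -/

lemma ofReal_k0 (D : Divisor F) :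
    ENNReal.ofReal (k0 D) = ∑' f : {f : F // f ∈ ideal D},
      ENNReal.ofReal (Real.exp (-Real.pi * normSq D f)) :=
  ENNReal.ofReal_tsum_of_nonneg (fun _ ↦ (Real.exp_pos _).le) (summable_k0 D)

lemma measurable_normSq_slice (x : HeightOneSpectrum (𝓞 F) →₀ ℤ) (f : F) :
    Measurable fun y : InfinitePlace F → ℝ ↦ normSq ((x, y) : Divisor F) f := by
  unfold normSq
  fun_prop

/-- For a fixed finite part, `k⁰` is a countable sum of nonnegative measurable functions; it is
summed in `ℝ≥0∞`. -/
lemma measurable_k0 : Measurable (k0 : Divisor F → ℝ) := by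
  have h : Measurable fun D : Divisor F ↦ ENNReal.ofReal (k0 D) := by
    refine measurable_of_slices fun x ↦ ?_
    have := countable_numberField F
    simp_rw [ofReal_k0]
    exact Measurable.tsum (L := .unconditional _)
      (f := fun (f : {f : F // f ∈ ideal ((x, 0) : Divisor F)}) (y : InfinitePlace F → ℝ) ↦
        ENNReal.ofReal (Real.exp (-Real.pi * normSq ((x, y) : Divisor F) f))) fun f ↦
      ((measurable_normSq_slice x f).const_mul _).exp.ennreal_ofReal
  convert! h.ennreal_toReal with D
  exact (ENNReal.toReal_ofReal (zero_le_one.trans (one_le_k0 D))).symm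

lemma measurable_effectivity : Measurable (effectivity : Divisor F → ℝ) := by
  refine measurable_of_slices fun x ↦ ?_
  by_cases h : 1 ≤ ideal ((x, 0) : Divisor F)
  · have : (fun y ↦ effectivity ((x, y) : Divisor F)) =
        fun y ↦ Real.exp (-Real.pi * normSq ((x, y) : Divisor F) 1) := by
      ext y; exact if_pos h
    rw [this]
    exact ((measurable_normSq_slice x 1).const_mul _).exp
  · have : (fun y ↦ effectivity ((x, y) : Divisor F)) = fun _ ↦ 0 := by
      ext y; exact if_neg h
    rw [this]
    exact measurable_const

lemma measurable_degree : Measurable (degree : Divisor F → ℝ) := by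
  refine measurable_of_slices fun x ↦ ?_
  unfold degree
  fun_prop

lemma measurable_picH0 : Measurable (picH0 : Pic F → ℝ) :=
  measurable_pic_iff.mpr measurable_k0.log

lemma measurable_defect : Measurable (defect : Pic F → ℝ) := by
  rw [measurable_pic_iff]
  simp_rw [defect_mk]
  exact measurable_const.sub measurable_degree

lemma effectivity_nonneg (D : Divisor F) : 0 ≤ effectivity D := by
  rw [effectivity]
  split_ifs
  exacts [(Real.exp_pos _).le, le_rfl]

/-! ### Unfolding the zeta integral -/

open Classical in
lemma effectivity_add_principal (D : Divisor F) (g : Additive Fˣ) :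
    effectivity (D + principal F g) = if (g.toMul : F) ∈ ideal D then
      Real.exp (-Real.pi * normSq D (g.toMul : F)) else 0 := by
  rw [effectivity, FractionalIdeal.one_le, mem_ideal_add_principal, normSq_add_principal, one_mul]

/-- The term of `f = 0` in `k⁰(D)` is `1`, and that of `f = g` is the effectivity of `D + (g)`. -/
lemma ofReal_k0_sub_one (D : Divisor F) : ENNReal.ofReal (k0 D - 1) =
    ∑' g : Additive Fˣ, ENNReal.ofReal (effectivity (D + principal F g)) := by
  classical
  let t : F → ENNReal := fun f ↦
    ENNReal.ofReal (if f ∈ ideal D then Real.exp (-Real.pi * normSq D f) else 0)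
  have h1 : ENNReal.ofReal (k0 D) = ∑' f, t f := by
    rw [ofReal_k0]
    refine (tsum_subtype {f | f ∈ ideal D} fun f ↦
      ENNReal.ofReal (Real.exp (-Real.pi * normSq D f))).trans ?_
    refine tsum_congr fun f ↦ ?_
    simp only [t, Set.indicator_apply, Set.mem_ofPred_eq]
    split_ifs
    · rfl
    · simp
  have h2 : ∑' f, t f = 1 + ∑' g : Additive Fˣ, t (g.toMul : F) := by
    rw [← ENNReal.summable.tsum_add_tsum_compl (s := {0}) ENNReal.summable]
    congr 1
    · simp [t, normSq, FractionalIdeal.zero_mem]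
    · exact ((unitsEquivNeZero (G₀ := F)).tsum_eq fun f ↦ t f).symm
  have h3 : ENNReal.ofReal (k0 D - 1) = ENNReal.ofReal (k0 D) - 1 := by
    rw [ENNReal.ofReal_sub _ zero_le_one, ENNReal.ofReal_one]
  rw [h3, h1, h2, ENNReal.add_sub_cancel_left ENNReal.one_ne_top]
  exact tsum_congr fun g ↦ by rw [effectivity_add_principal]

/-- The kernel of `f ↦ (f)` consists of the roots of unity, the units all of whose absolute values
are `1`. -/
lemma mem_ker_principal_iff (g : Additive Fˣ) : principal F g = 0 ↔
    ∃ u ∈ Units.torsion F, (g.toMul : F) = ((u : 𝓞 F) : F) := by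
  constructor
  · intro h
    have hint := isIntegral_of_principal_fst_eq_zero (g := g) (by rw [h]; rfl)
    have hint' := isIntegral_of_principal_fst_eq_zero (g := -g) (by rw [map_neg, h, neg_zero]; rfl)
    let u : (𝓞 F)ˣ := ⟨⟨g.toMul, hint⟩, ⟨(-g).toMul, hint'⟩,
      RingOfIntegers.ext (Units.mul_inv g.toMul), RingOfIntegers.ext (Units.inv_mul g.toMul)⟩
    refine ⟨u, (Units.mem_torsion F).mpr fun σ ↦ ?_, rfl⟩
    have h1 : -(σ.mult * Real.log (σ (g.toMul : F))) = 0 := congrFun (congrArg Prod.snd h) σ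
    have hpos : 0 < σ (g.toMul : F) := by simp [InfinitePlace.pos_iff]
    have h2 : Real.log (σ (g.toMul : F)) = 0 := by
      simpa [InfinitePlace.mult_ne_zero] using h1
    exact Real.eq_one_of_pos_of_log_eq_zero hpos h2
  · rintro ⟨u, hu, hg⟩
    refine Prod.ext ?_ (funext fun σ ↦ ?_)
    · have h1 : FractionalIdeal.spanSingleton (𝓞 F)⁰ (g.toMul : F) = 1 := by
        rw [hg, ← FractionalIdeal.coeIdeal_span_singleton, Ideal.span_singleton_eq_top.mpr u.isUnit,
          FractionalIdeal.coeIdeal_top]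
      change idealDivisor (FractionalIdeal.spanSingleton (𝓞 F)⁰ (g.toMul : F)) = 0
      rw [h1]
      ext v
      exact FractionalIdeal.count_one F v
    · change -(σ.mult * Real.log (σ (g.toMul : F))) = 0
      rw [hg, (Units.mem_torsion F).mp hu σ, Real.log_one, mul_zero, neg_zero]

variable (F) in
lemma card_ker_principal : Nat.card (principal F).rangeRestrict.ker = Units.torsionOrder F := by
  symm
  have hmem (u : Units.torsion F) :
      Additive.ofMul (Units.map (algebraMap (𝓞 F) F).toMonoidHom u.1) ∈
        (principal F).rangeRestrict.ker := by
    rw [AddMonoidHom.ker_rangeRestrict, AddMonoidHom.mem_ker, mem_ker_principal_iff]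
    exact ⟨u, u.2, rfl⟩
  refine Nat.card_congr (Equiv.ofBijective (fun u ↦ ⟨_, hmem u⟩) ⟨fun u v huv ↦ ?_, fun g ↦ ?_⟩)
  · have h1 := congrArg (fun g ↦ ((Additive.toMul g.1 : Fˣ) : F)) huv
    exact Subtype.ext (Units.ext (RingOfIntegers.ext h1))
  · obtain ⟨u, hu, hg⟩ := (mem_ker_principal_iff g.1).mp (congrArg Subtype.val g.2)
    refine ⟨⟨u, hu⟩, Subtype.ext ?_⟩
    exact Additive.toMul.injective (Units.ext hg.symm)

/-- The terms of `k⁰(D) - 1` are the effectivities of the divisors linearly equivalent to `D`,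
each counted once for every root of unity. -/
lemma torsionOrder_mul_tsum_effectivity (D : Divisor F) :
    (Units.torsionOrder F : ENNReal) * ∑' γ : (principal F).range,
      ENNReal.ofReal (effectivity (γ +ᵥ D)) = ENNReal.ofReal (k0 D - 1) := by
  rw [ofReal_k0_sub_one, ← (Equiv.sigmaFiberEquiv (principal F).rangeRestrict).tsum_eq,
    ENNReal.tsum_sigma', ← ENNReal.tsum_mul_left]
  refine tsum_congr fun γ ↦ ?_
  have hcard : Nat.card {g // (principal F).rangeRestrict g = γ} = Units.torsionOrder F := by
    rw [← card_ker_principal F]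
    exact Nat.card_congr
      (AddMonoidHom.fiberEquivKerOfSurjective (principal F).rangeRestrict_surjective γ)
  have : Finite {g // (principal F).rangeRestrict g = γ} :=
    Nat.finite_of_card_ne_zero (hcard ▸ Units.torsionOrder_ne_zero F)
  have := Fintype.ofFinite {g // (principal F).rangeRestrict g = γ}
  have hterm (g : {g // (principal F).rangeRestrict g = γ}) :
      ENNReal.ofReal (effectivity (D + principal F (Equiv.sigmaFiberEquiv
        (principal F).rangeRestrict ⟨γ, g⟩))) = ENNReal.ofReal (effectivity (γ +ᵥ D)) := by
    have : principal F g.1 = γ := congrArg Subtype.val g.2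
    change ENNReal.ofReal (effectivity (D + principal F g.1)) = _
    rw [this, add_comm]
    rfl
  simp_rw [hterm]
  rw [tsum_fintype, Finset.sum_const, Finset.card_univ, ← Nat.card_eq_fintype_card, hcard,
    nsmul_eq_mul]

lemma mk_vadd (γ : (principal F).range) (D : Divisor F) : ((γ +ᵥ D : Divisor F) : Pic F) = D := by
  change (((γ : Divisor F) + D : Divisor F) : Pic F) = D
  rw [QuotientAddGroup.mk_add, (QuotientAddGroup.eq_zero_iff _).mpr γ.2, zero_add]

/-- Integrals over `Div(F)` against the effectivity are integrals over `Pic(F)` against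
`k⁰ - 1`. -/
lemma lintegral_effectivity_mul {g : Pic F → ENNReal} (hg : Measurable g) :
    (Units.torsionOrder F : ENNReal) *
      ∫⁻ D, ENNReal.ofReal (effectivity D) * g (D : Pic F) ∂divMeasure F =
    ∫⁻ c, ENNReal.ofReal (Real.exp (picH0 c) - 1) * g c ∂picMeasure F := by
  obtain ⟨S, hS, hinj, hsurj⟩ := exists_transversal F
  have hdom := isAddFundamentalDomain_of_transversal hS hinj hsurj
  have hgm : Measurable fun D : Divisor F ↦ g (D : Pic F) := hg.comp measurable_mk
  have hm : Measurable fun c : Pic F ↦ ENNReal.ofReal (Real.exp (picH0 c) - 1) * g c :=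
    (measurable_picH0.exp.sub_const 1).ennreal_ofReal.mul hg
  rw [picMeasure_eq_map hS hinj hsurj, lintegral_map hm measurable_mk,
    hdom.lintegral_eq_tsum'', ← lintegral_tsum, ← lintegral_const_mul]
  · refine lintegral_congr fun D ↦ ?_
    simp_rw [mk_vadd, ENNReal.tsum_mul_right, ← mul_assoc]
    rw [torsionOrder_mul_tsum_effectivity, exp_picH0_mk]
  · exact Measurable.tsum fun γ ↦
      ((measurable_effectivity.ennreal_ofReal.mul hgm).comp (measurable_const_vadd γ))
  · exact fun γ ↦ ((measurable_effectivity.ennreal_ofReal.mul hgm).comp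
      (measurable_const_vadd γ)).aemeasurable

end Unfolding

/-! ### Convergence of the zeta integral -/

section Convergence
variable {F : Type*} [Field F] [NumberField F]
open Filter Asymptotics

variable (F) in
/-- The Dedekind zeta function converges to the right of `1`. The zero ideal contributes
`0 ^ (-c) = 0`. -/
lemma tsum_absNorm_rpow_lt_top {c : ℝ} (hc : 1 < c) :
    ∑' J : Ideal (𝓞 F), ENNReal.ofReal ((Ideal.absNorm J : ℝ) ^ (-c)) < ⊤ := by
  -- the number of ideals of norm at most `n` is `O(n)`
  have hlim := (NumberField.Ideal.tendsto_norm_le_div_atTop₀ F).comp tendsto_natCast_atTop_atTop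
  have hO : (fun n : ℕ ↦ ∑ k ∈ Finset.Icc 1 n,
      (Nat.card {I : Ideal (𝓞 F) // Ideal.absNorm I = k} : ℝ)) =O[atTop]
        fun n ↦ (n : ℝ) ^ (1 : ℝ) := by
    simp_rw [Real.rpow_one]
    refine isBigO_of_div_tendsto_nhds (eventually_atTop.mpr ⟨1, fun n hn h ↦ ?_⟩) _
      (hlim.congr fun n ↦ ?_)
    · exact absurd h (by positivity)
    · simp only [Function.comp_apply, Nat.cast_le, Pi.div_apply, ← Nat.cast_sum]
      congr
      rw [← add_left_inj 1, ← Ideal.card_norm_le_eq_card_norm_le_add_one,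
        show Finset.Icc 1 n = Finset.Ioc 0 n from Finset.Icc_succ_left_eq_Ioc _ _,
        show 1 = Nat.card {I : Ideal (𝓞 F) // Ideal.absNorm I = 0} by
          simp [Ideal.absNorm_eq_zero_iff],
        Finset.sum_Ioc_add_eq_sum_Icc (n.zero_le),
        ← Finset.card_preimage_eq_sum_card_image_eq
          (fun k _ ↦ Ideal.finite_setOfPred_absNorm_eq k)]
      simp [Set.coe_eq_subtype]
  have hsum := (LSeriesSummable_of_sum_norm_bigO_and_nonneg (s := (c : ℂ)) hO
    (fun _ ↦ Nat.cast_nonneg _) zero_le_one (by simpa using hc)).norm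
  have hterm (n : ℕ) : ∑' J : {J : Ideal (𝓞 F) // Ideal.absNorm J = n},
      ENNReal.ofReal ((Ideal.absNorm J.1 : ℝ) ^ (-c)) = ENNReal.ofReal
        ‖LSeries.term (fun n ↦ ((Nat.card {I : Ideal (𝓞 F) // Ideal.absNorm I = n} : ℝ) : ℂ))
          c n‖ := by
    have hfin : Finite {J : Ideal (𝓞 F) // Ideal.absNorm J = n} :=
      Ideal.finite_setOfPred_absNorm_eq n
    have := Fintype.ofFinite {J : Ideal (𝓞 F) // Ideal.absNorm J = n}
    rw [LSeries.norm_term_eq, tsum_fintype, Finset.sum_congr rfl fun J _ ↦ by rw [J.2]]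
    split_ifs with hn
    · subst hn
      simp [Real.zero_rpow (show -c ≠ 0 by linarith)]
    · rw [Finset.sum_const, Finset.card_univ, ← Nat.card_eq_fintype_card, nsmul_eq_mul,
        Complex.ofReal_re, Complex.norm_real, Real.norm_natCast, div_eq_mul_inv,
        ENNReal.ofReal_mul (Nat.cast_nonneg _), ENNReal.ofReal_natCast,
        Real.rpow_neg (Nat.cast_nonneg _)]
  rw [← (Equiv.sigmaFiberEquiv fun J : Ideal (𝓞 F) ↦ Ideal.absNorm J).tsum_eq,
    ENNReal.tsum_sigma']
  simp only [Equiv.sigmaFiberEquiv, Equiv.coe_fn_mk]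
  rw [tsum_congr hterm]
  exact hsum.tsum_ofReal_lt_top

/-- The finite part of a divisor is determined by its ideal. -/
lemma ideal_injective {D E : Divisor F} (h : ideal D = ideal E) : D.1 = E.1 := by
  have key (D : Divisor F) (v : HeightOneSpectrum (𝓞 F)) :
      FractionalIdeal.count F v (ideal (-D)) = D.1 v := by
    rw [← FractionalIdeal.count_finsuppProd F v D.1, ideal]
    congr 1
    rw [Prod.fst_neg, Finsupp.prod_neg_index (by simp)]
    simp
  ext v
  rw [← key D, ← key E, ideal_neg, ideal_neg, h]

/-- The effective finite parts of divisors are the nonzero ideals, so that the sum of `N^(-c)` over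
them converges for `c > 1`. -/
lemma tsum_effective_lt_top {c : ℝ} (hc : 1 < c) :
    ∑' x : {x : HeightOneSpectrum (𝓞 F) →₀ ℤ // 1 ≤ ideal ((x, 0) : Divisor F)},
      ENNReal.ofReal (Real.exp (-c * degree ((x.1, 0) : Divisor F))) < ⊤ := by
  have hJ (x : {x : HeightOneSpectrum (𝓞 F) →₀ ℤ // 1 ≤ ideal ((x, 0) : Divisor F)}) :
      ∃ J : Ideal (𝓞 F), (J : FractionalIdeal (𝓞 F)⁰ F) = ideal (-(x.1, 0) : Divisor F) := by
    refine FractionalIdeal.le_one_iff_exists_coeIdeal.mp ?_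
    rw [ideal_neg]
    have h := mul_le_mul_right x.2 (ideal ((x.1, 0) : Divisor F))⁻¹
    rwa [mul_one, inv_mul_cancel₀ (ideal_ne_zero _)] at h
  choose J hJ using hJ
  have hinj : Function.Injective J := fun x y hxy ↦ by
    have h := (hJ x).symm.trans ((congrArg _ hxy).trans (hJ y))
    have h1 := ideal_injective h
    exact Subtype.ext (neg_injective h1)
  refine lt_of_eq_of_lt (tsum_congr fun x ↦ ?_) ((ENNReal.tsum_comp_le_tsum_of_injective hinj
    fun J ↦ ENNReal.ofReal ((Ideal.absNorm J : ℝ) ^ (-c))).trans_lt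
      (tsum_absNorm_rpow_lt_top F hc))
  have h1 : (Ideal.absNorm (J x) : ℝ) = Real.exp (degree ((x.1, 0) : Divisor F)) := by
    have h2 := norm_eq_exp_div_absNorm ((x.1, 0) : Divisor F)
    have h3 := congrArg (fun q : ℚ ↦ (q : ℝ))
      ((congrArg FractionalIdeal.absNorm (hJ x)).trans
        ((congrArg _ (ideal_neg _)).trans (map_inv₀ _ _)))
    simp only [FractionalIdeal.coeIdeal_absNorm, Rat.cast_natCast, Rat.cast_inv] at h3
    rw [h3, ← one_div, ← norm, h2]
    simp
  rw [h1, ← Real.exp_mul]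
  ring_nf

/-- The archimedean factor of the zeta integral, a gamma integral. -/
lemma integrable_archimedean {c m : ℝ} (hc : 0 < c) (hm : 1 ≤ m) :
    Integrable fun y : ℝ ↦ Real.exp (-Real.pi * (m * Real.exp (-2 * y / m)) - c * y) := by
  -- this `n` makes the bound `n! exp (2 n y / m)` at most `n! exp (2 c y)` for `y ≤ 0`
  obtain ⟨n, hn⟩ := exists_nat_ge (c * m)
  have hm0 : 0 < m := zero_lt_one.trans_le hm
  have hcont : Continuous fun y : ℝ ↦
      Real.exp (-Real.pi * (m * Real.exp (-2 * y / m)) - c * y) := by fun_prop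
  rw [← integrableOn_univ, ← Set.Iic_union_Ioi (a := (0 : ℝ))]
  refine IntegrableOn.union (((integrableOn_exp_mul_Iic hc 0).const_mul (n.factorial : ℝ)).mono'
    hcont.aestronglyMeasurable ?_) ((integrableOn_exp_mul_Ioi (neg_lt_zero.mpr hc) 0).mono'
    hcont.aestronglyMeasurable ?_)
  · refine (ae_restrict_iff' measurableSet_Iic).mpr (.of_forall fun y hy ↦ ?_)
    have hy : y ≤ 0 := hy
    rw [Real.norm_of_nonneg (Real.exp_pos _).le]
    -- `v ^ n / n! ≤ exp v` at `v = π m exp (-2 y / m)`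
    set v := Real.pi * (m * Real.exp (-2 * y / m)) with hv
    have h1 := Real.pow_div_factorial_le_exp v (by positivity) n
    have h2 : Real.exp (-2 * c * y) ≤ v ^ n := by
      have h3 : Real.exp (-2 * y / m) ≤ v := by
        rw [hv, ← mul_assoc]
        refine le_mul_of_one_le_left (Real.exp_pos _).le ?_
        nlinarith [Real.pi_gt_three]
      refine le_trans ?_ (pow_le_pow_left₀ (Real.exp_pos _).le h3 n)
      rw [← Real.exp_nat_mul, Real.exp_le_exp]
      have : (n : ℝ) * (-2 * y / m) = (n / m) * (-2 * y) := by ring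
      rw [this]
      have : c ≤ n / m := (le_div_iff₀ hm0).mpr hn
      nlinarith
    have h3 : Real.exp (-2 * c * y) ≤ n.factorial * Real.exp v := by
      rw [div_le_iff₀ (by positivity)] at h1
      linarith
    have h4 : Real.exp (-Real.pi * (m * Real.exp (-2 * y / m)) - c * y) =
        Real.exp (-2 * c * y) * (Real.exp (-v) * Real.exp (c * y)) := by
      rw [← Real.exp_add, ← Real.exp_add, hv]
      ring_nf
    rw [h4]
    calc _ ≤ (n.factorial * Real.exp v) * (Real.exp (-v) * Real.exp (c * y)) := by gcongr
      _ = n.factorial * Real.exp (c * y) * (Real.exp v * Real.exp (-v)) := by ring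
      _ = n.factorial * Real.exp (c * y) := by rw [← Real.exp_add, add_neg_cancel]; simp
  · refine (ae_restrict_iff' measurableSet_Ioi).mpr (.of_forall fun y _ ↦ ?_)
    rw [Real.norm_of_nonneg (Real.exp_pos _).le, Real.exp_le_exp]
    have : 0 < Real.pi * (m * Real.exp (-2 * y / m)) := by positivity
    linarith

/-- The zeta integral converges absolutely to the right of `1`: it is the product of the Dedekind
zeta function and of the archimedean factors. -/
lemma lintegral_effectivity_exp_lt_top {c : ℝ} (hc : 1 < c) :
    ∫⁻ D, ENNReal.ofReal (effectivity D) * ENNReal.ofReal (Real.exp (-c * degree D))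
      ∂divMeasure F < ⊤ := by
  let f (y : InfinitePlace F → ℝ) : ENNReal := ENNReal.ofReal (∏ σ, Real.exp
    (-Real.pi * ((σ.mult : ℝ) * Real.exp (-2 * y σ / σ.mult)) - c * y σ))
  have hf : ∫⁻ y, f y < ⊤ := by
    refine Integrable.lintegral_lt_top ?_
    exact Integrable.fintype_prod (f := fun (σ : InfinitePlace F) (y : ℝ) ↦ Real.exp
      (-Real.pi * ((σ.mult : ℝ) * Real.exp (-2 * y / σ.mult)) - c * y)) fun σ ↦
      integrable_archimedean (zero_lt_one.trans hc) (by exact_mod_cast σ.mult_pos)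
  have hm : Measurable fun D : Divisor F ↦
      ENNReal.ofReal (effectivity D) * ENNReal.ofReal (Real.exp (-c * degree D)) :=
    measurable_effectivity.ennreal_ofReal.mul
      (measurable_degree.const_mul _).exp.ennreal_ofReal
  rw [divMeasure, lintegral_prod _ hm.aemeasurable, lintegral_count]
  have hterm (x : HeightOneSpectrum (𝓞 F) →₀ ℤ) :
      ∫⁻ y, ENNReal.ofReal (effectivity ((x, y) : Divisor F)) *
        ENNReal.ofReal (Real.exp (-c * degree ((x, y) : Divisor F))) =
      Set.indicator {x | 1 ≤ ideal ((x, 0) : Divisor F)}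
        (fun x ↦ ENNReal.ofReal (Real.exp (-c * degree ((x, 0) : Divisor F)))) x *
          ∫⁻ y, f y := by
    by_cases hx : 1 ≤ ideal ((x, 0) : Divisor F)
    · rw [Set.indicator_of_mem (s := {x | 1 ≤ ideal ((x, 0) : Divisor F)}) hx,
        ← lintegral_const_mul' _ _ ENNReal.ofReal_ne_top]
      refine lintegral_congr fun y ↦ ?_
      have he : effectivity ((x, y) : Divisor F) =
          Real.exp (-Real.pi * normSq ((x, y) : Divisor F) 1) := if_pos hx
      rw [he, ← ENNReal.ofReal_mul (Real.exp_pos _).le, ← ENNReal.ofReal_mul (Real.exp_pos _).le,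
        ← Real.exp_sum, ← Real.exp_add, ← Real.exp_add, Finset.sum_sub_distrib, ← Finset.mul_sum,
        ← Finset.mul_sum]
      congr 2
      simp only [normSq, degree, map_one, one_pow, one_mul, Pi.zero_apply, Finset.sum_const_zero]
      ring
    · rw [Set.indicator_of_notMem (s := {x | 1 ≤ ideal ((x, 0) : Divisor F)}) hx, zero_mul]
      refine (lintegral_congr fun y ↦ ?_).trans lintegral_zero
      have he : effectivity ((x, y) : Divisor F) = 0 := if_neg hx
      rw [he, ENNReal.ofReal_zero, zero_mul]
  rw [tsum_congr hterm, ENNReal.tsum_mul_right]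
  refine ENNReal.mul_lt_top ?_ hf
  rw [← tsum_subtype]
  exact tsum_effective_lt_top hc

end Convergence

/-! ### Symmetries and the volume of the Arakelov class group -/

section Volume
variable {F : Type*} [Field F] [NumberField F]

/-- Symmetries of `Div(F)` that descend to `Pic(F)` preserve the measure of `Pic(F)`. -/
lemma measurePreserving_pic {τ : Divisor F ≃ Divisor F}
    (hτ : MeasurePreserving τ (divMeasure F) (divMeasure F)) {τ' : Pic F → Pic F}
    (hτ' : Function.Injective τ') (h : ∀ D : Divisor F, τ' D = (τ D : Divisor F)) :
    MeasurePreserving τ' (picMeasure F) (picMeasure F) := by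
  obtain ⟨S, hS, hinj, hsurj⟩ := exists_transversal F
  have hmeas : Measurable τ' := measurable_pic_iff.mpr <| by
    simp_rw [h]
    exact measurable_mk.comp hτ.measurable
  refine ⟨hmeas, ?_⟩
  -- the preimage of a set of representatives is another one
  have hT := picMeasure_eq_map (hτ.measurable hS)
    (fun x hx y hy hxy ↦ τ.injective (hinj hx hy (by rw [← h, ← h, hxy])))
    (fun x ↦ by
      obtain ⟨z, hz, hzx⟩ := hsurj (τ x)
      refine ⟨τ.symm z, by rwa [Set.mem_preimage, τ.apply_symm_apply], hτ' ?_⟩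
      rw [h, h, τ.apply_symm_apply, hzx])
  rw [hT, Measure.map_map hmeas measurable_mk, show τ' ∘ QuotientAddGroup.mk =
    QuotientAddGroup.mk ∘ τ from funext h, ← Measure.map_map measurable_mk hτ.measurable,
    (hτ.restrict_preimage hS).map_eq, ← picMeasure_eq_map hS hinj hsurj, ← hT]

lemma measurePreserving_reflect :
    MeasurePreserving (reflect : Pic F → Pic F) (picMeasure F) (picMeasure F) :=
  measurePreserving_pic (τ := Equiv.subLeft (canonicalDivisor F))
    (Measure.measurePreserving_sub_left (divMeasure F) (canonicalDivisor F))
    (Equiv.subLeft (canonicalDivisor F : Pic F)).injective fun _ ↦ rfl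

lemma measurePreserving_add_left_pic (D : Divisor F) :
    MeasurePreserving (fun c : Pic F ↦ (D : Pic F) + c) (picMeasure F) (picMeasure F) :=
  measurePreserving_pic (τ := Equiv.addLeft D) (measurePreserving_add_left (divMeasure F) D)
    (Equiv.addLeft (D : Pic F)).injective fun _ ↦ rfl

lemma exp_mul_defect_mk (c : ℝ) (D : Divisor F) : Real.exp (c * defect (D : Pic F)) =
    Real.exp (c * Real.log √|(discr F : ℝ)|) * Real.exp (-c * degree D) := by
  rw [defect_mk, ← Real.exp_add]
  ring_nf

/-- The convergence of the zeta integral, transported to `Pic(F)`. -/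
lemma lintegral_pic_lt_top {c : ℝ} (hc : 1 < c) :
    ∫⁻ x, ENNReal.ofReal (Real.exp (picH0 x) - 1) * ENNReal.ofReal (Real.exp (c * defect x))
      ∂picMeasure F < ⊤ := by
  rw [← lintegral_effectivity_mul (measurable_defect.const_mul c).exp.ennreal_ofReal]
  refine ENNReal.mul_lt_top (ENNReal.natCast_lt_top _) ?_
  simp_rw [exp_mul_defect_mk, ENNReal.ofReal_mul (Real.exp_pos _).le,
    mul_left_comm (ENNReal.ofReal (effectivity _))]
  rw [lintegral_const_mul' _ _ ENNReal.ofReal_ne_top]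
  exact ENNReal.mul_lt_top ENNReal.ofReal_lt_top (lintegral_effectivity_exp_lt_top hc)

lemma exp_picH0_sub_one_nonneg (x : Pic F) : 0 ≤ Real.exp (picH0 x) - 1 :=
  sub_nonneg.mpr (Real.one_le_exp (picH0_nonneg x))

lemma integrable_pic {c : ℝ} (hc : 1 < c) :
    Integrable (fun x ↦ (Real.exp (picH0 x) - 1) * Real.exp (c * defect x)) (picMeasure F) := by
  refine ⟨((measurable_picH0.exp.sub_const 1).mul
    (measurable_defect.const_mul c).exp).aestronglyMeasurable, ?_⟩
  rw [hasFiniteIntegral_iff_ofReal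
    (.of_forall fun x ↦ mul_nonneg (exp_picH0_sub_one_nonneg x) (Real.exp_pos _).le)]
  simp_rw [ENNReal.ofReal_mul (exp_picH0_sub_one_nonneg _)]
  exact lintegral_pic_lt_top hc

variable (F) in
/-- The image of the measure of `Pic(F)` under `h¹ - h⁰` is a finite multiple of Lebesgue measure:
it is translation invariant, and where the degree is large it is dominated by the convergent zeta
integral, because there `k⁰` is bounded below by Riemann–Roch. -/
lemma exists_map_defect_eq : ∃ V : NNReal, (picMeasure F).map defect = V • volume := by
  set m := (picMeasure F).map (defect : Pic F → ℝ) with hm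
  have hinv : m.IsAddLeftInvariant := by
    refine ⟨fun r ↦ ?_⟩
    -- translation by a divisor of degree `-r`
    let D : Divisor F := (0, fun _ ↦ -(r / Fintype.card (InfinitePlace F)))
    have hD (x : Pic F) : r + defect x = defect ((D : Pic F) + x) := by
      obtain ⟨E, rfl⟩ := QuotientAddGroup.mk_surjective x
      have hadd : degree (D + E) = degree E - r := by
        have hcard : (Fintype.card (InfinitePlace F) : ℝ) ≠ 0 :=
          Nat.cast_ne_zero.mpr Fintype.card_ne_zero
        simp only [degree, D, Prod.fst_add, zero_add, Prod.snd_add, Pi.add_apply,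
          Finset.sum_add_distrib, Finset.sum_const, Finset.card_univ, nsmul_eq_mul]
        field_simp
        ring
      rw [← QuotientAddGroup.mk_add, defect_mk, defect_mk, hadd]
      ring
    rw [hm, Measure.map_map (measurable_const_add r) measurable_defect]
    conv_rhs => rw [← (measurePreserving_add_left_pic D).map_eq]
    rw [Measure.map_map measurable_defect (measurePreserving_add_left_pic D).measurable]
    exact congrArg (fun f ↦ Measure.map f _) (funext hD)
  have hfin : m (Set.Ioo (-2) (-1)) ≠ ⊤ := by
    refine ne_top_of_le_ne_top (ENNReal.mul_ne_top (ENNReal.ofReal_ne_top (r := Real.exp 4))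
      (lintegral_pic_lt_top (F := F) one_lt_two).ne) ?_
    rw [hm, Measure.map_apply measurable_defect measurableSet_Ioo,
      ← lintegral_const_mul' _ _ ENNReal.ofReal_ne_top,
      ← lintegral_indicator_one (measurable_defect measurableSet_Ioo)]
    refine lintegral_mono (Set.indicator_le fun x hx ↦ ?_)
    obtain ⟨h1, h2⟩ : -2 < defect x ∧ defect x < -1 := hx
    rw [Pi.one_apply, ← ENNReal.ofReal_mul (exp_picH0_sub_one_nonneg _),
      ← ENNReal.ofReal_mul (Real.exp_pos _).le, ENNReal.one_le_ofReal]
    have h3 : 1 ≤ picH0 x := by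
      have := picH1_nonneg x
      rw [defect] at h2
      linarith
    have h4 : 1 ≤ Real.exp (picH0 x) - 1 := by
      have := Real.add_one_le_exp (picH0 x)
      linarith
    have h5 : 1 ≤ Real.exp 4 * Real.exp (2 * defect x) := by
      rw [← Real.exp_add]
      exact Real.one_le_exp (by linarith)
    nlinarith
  have hcomp : IsFiniteMeasureOnCompacts m := ⟨fun K hK ↦
    measure_lt_top_of_isCompact_of_isAddLeftInvariant _ isOpen_Ioo ⟨-3 / 2, by norm_num⟩ hfin hK⟩
  exact ⟨_, Measure.isAddLeftInvariant_eq_smul m volume⟩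

lemma k0_le_k0 {D E : Divisor F} (h1 : D.1 = E.1) (h2 : ∀ σ, D.2 σ ≤ E.2 σ) : k0 D ≤ k0 E := by
  have hI : ideal D = ideal E := by rw [ideal, ideal, h1]
  have hS := summable_k0 D
  rw [k0] at *
  rw [k0]
  rw [hI] at hS ⊢
  refine hS.tsum_le_tsum (fun f ↦ Real.exp_le_exp.mpr ?_) (summable_k0 E)
  refine mul_le_mul_of_nonpos_left (Finset.sum_le_sum fun σ _ ↦ ?_)
    (neg_nonpos.mpr Real.pi_pos.le)
  have := σ.mult_pos
  gcongr ?_ * (_ * Real.exp (?_ / _))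
  linarith [h2 σ]

variable (F) in
/-- On the classes of degree at most `log √|Δ|`, `h⁰` is bounded: `k⁰ - 1` is monotone in the
infinite components, so that it is bounded by its mean over a small box, hence by a multiple of the
zeta integral. -/
lemma exists_picH0_le : ∃ A : ℝ, ∀ x : Pic F, 0 ≤ defect x → picH0 x ≤ A := by
  obtain ⟨ε, hε, hinj⟩ := exists_injOn_box F
  set n := Fintype.card (InfinitePlace F)
  set J := ∫⁻ x, ENNReal.ofReal (Real.exp (picH0 x) - 1) * ENNReal.ofReal (Real.exp (2 * defect x))
      ∂picMeasure F
  have hJfin : J ≠ ⊤ := (lintegral_pic_lt_top one_lt_two).ne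
  refine ⟨Real.log (J.toReal * Real.exp (2 * (n * ε)) / ε ^ n + 1), fun x hx ↦ ?_⟩
  obtain ⟨D, rfl⟩ := QuotientAddGroup.mk_surjective x
  rw [picH0_mk]
  refine Real.log_le_log (zero_lt_one.trans_le (one_le_k0 D)) ?_
  rw [← sub_le_iff_le_add, le_div_iff₀ (by positivity)]
  have hle : ((divMeasure F).restrict (box ε D)).map QuotientAddGroup.mk ≤ picMeasure F :=
    le_iSup_of_le (box ε D) (le_iSup_of_le (measurableSet_box ε D)
      (le_iSup_of_le (hinj D) le_rfl))
  have hbound : ENNReal.ofReal ((k0 D - 1) * ε ^ n * Real.exp (-(2 * (n * ε)))) ≤ J := by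
    have hmeas : Measurable fun x : Pic F ↦ ENNReal.ofReal (Real.exp (picH0 x) - 1) *
        ENNReal.ofReal (Real.exp (2 * defect x)) :=
      (measurable_picH0.exp.sub_const 1).ennreal_ofReal.mul
        (measurable_defect.const_mul 2).exp.ennreal_ofReal
    refine le_trans ?_ (lintegral_mono' hle le_rfl)
    rw [lintegral_map hmeas measurable_mk]
    calc _ = ∫⁻ _ in box ε D, ENNReal.ofReal ((k0 D - 1) * Real.exp (-(2 * (n * ε))))
          ∂divMeasure F := by
          rw [setLIntegral_const, divMeasure_box, show Fintype.card (InfinitePlace F) = n from rfl,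
            ← ENNReal.ofReal_pow hε.le,
            ← ENNReal.ofReal_mul (mul_nonneg (sub_nonneg.mpr (one_le_k0 D)) (Real.exp_pos _).le)]
          ring_nf
      _ ≤ _ := by
          refine setLIntegral_mono' (measurableSet_box ε D) fun E hE ↦ ?_
          have h1 : k0 D ≤ k0 E := k0_le_k0 hE.1.symm fun σ ↦ (hE.2 σ).1
          have h2 : degree E ≤ degree D + n * ε := by
            have : ∑ σ, E.2 σ ≤ ∑ σ, (D.2 σ + ε) :=
              Finset.sum_le_sum fun σ _ ↦ (hE.2 σ).2.le
            rw [Finset.sum_add_distrib, Finset.sum_const, Finset.card_univ, nsmul_eq_mul] at this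
            rw [degree, degree, hE.1]
            linarith
          have h3 : -(n * ε) ≤ defect (E : Pic F) := by
            have h4 := defect_mk D
            rw [defect_mk E]
            linarith
          rw [exp_picH0_mk, ← ENNReal.ofReal_mul (sub_nonneg.mpr (one_le_k0 E))]
          refine ENNReal.ofReal_le_ofReal (mul_le_mul (by linarith)
            (Real.exp_le_exp.mpr (by linarith)) (Real.exp_pos _).le
            (sub_nonneg.mpr (one_le_k0 E)))
  have h := (ENNReal.ofReal_le_iff_le_toReal hJfin).mp hbound
  calc (k0 D - 1) * ε ^ n
      = (k0 D - 1) * ε ^ n * Real.exp (-(2 * (n * ε))) * Real.exp (2 * (n * ε)) := by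
        rw [mul_assoc _ (Real.exp _) (Real.exp _), ← Real.exp_add, neg_add_cancel, Real.exp_zero,
          mul_one]
    _ ≤ _ := by gcongr

end Volume

/-! ### The two continuations -/

section Continuation
variable {F : Type*} [Field F] [NumberField F]

variable (F) in
/-- The unfolding identity as an equality of measures, which makes it available for complex-valued
integrands. -/
lemma map_effectivity_eq_withDensity : (Units.torsionOrder F : ENNReal) •
    ((divMeasure F).withDensity fun D ↦ ENNReal.ofReal (effectivity D)).map QuotientAddGroup.mk =
      (picMeasure F).withDensity fun c ↦ ENNReal.ofReal (Real.exp (picH0 c) - 1) := by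
  refine Measure.ext fun A hA ↦ ?_
  have h := lintegral_effectivity_mul (F := F) (g := A.indicator 1)
    (measurable_one.indicator hA)
  rw [Measure.smul_apply, Measure.map_apply measurable_mk hA, smul_eq_mul,
    withDensity_apply _ (measurable_mk hA), withDensity_apply _ hA, ← lintegral_indicator hA,
    ← lintegral_indicator (measurable_mk hA)]
  convert! h using 2
  · refine lintegral_congr fun D ↦ ?_
    by_cases hD : (D : Pic F) ∈ A <;> simp [hD]
  · ext c
    by_cases hc : c ∈ A <;> simp [hc]

lemma integral_effectivity_mul {g : Pic F → ℂ} (hg : Measurable g) :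
    ∫ c, ((Real.exp (picH0 c) - 1 : ℝ) : ℂ) * g c ∂picMeasure F =
      Units.torsionOrder F * ∫ D, (effectivity D : ℂ) * g (D : Pic F) ∂divMeasure F := by
  have h := congrArg (fun m ↦ ∫ c, g c ∂m) (map_effectivity_eq_withDensity F)
  simp only [integral_smul_measure, integral_map measurable_mk.aemeasurable
    hg.aestronglyMeasurable] at h
  rw [integral_withDensity_eq_integral_toReal_smul measurable_effectivity.ennreal_ofReal
      (.of_forall fun _ ↦ ENNReal.ofReal_lt_top),
    integral_withDensity_eq_integral_toReal_smul (measurable_picH0.exp.sub_const 1).ennreal_ofReal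
      (.of_forall fun _ ↦ ENNReal.ofReal_lt_top)] at h
  simp only [ENNReal.toReal_ofReal (exp_picH0_sub_one_nonneg _),
    ENNReal.toReal_ofReal (effectivity_nonneg _), ENNReal.toReal_natCast, Complex.real_smul,
    Complex.ofReal_natCast] at h
  exact h.symm

lemma norm_cpow (D : Divisor F) (s : ℂ) :
    (norm D : ℂ) ^ (-s) = Complex.exp (-s * degree D) := by
  rw [Complex.cpow_def_of_ne_zero (by exact_mod_cast (Real.exp_pos _).ne'), norm,
    ← Complex.ofReal_log (Real.exp_pos _).le, Real.log_exp, mul_comm]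

lemma cexp_mul_defect_mk (s : ℂ) (D : Divisor F) : Complex.exp (s * defect (D : Pic F)) =
    ((√|(discr F : ℝ)| : ℝ) : ℂ) ^ s * (norm D : ℂ) ^ (-s) := by
  rw [norm_cpow, Complex.cpow_def_of_ne_zero (by exact_mod_cast (sqrt_discr_pos F).ne'),
    ← Complex.ofReal_log (sqrt_discr_pos F).le, ← Complex.exp_add, defect_mk]
  push_cast
  ring_nf

lemma integrable_zetaIntegrand {s : ℂ} (hs : 1 < s.re) :
    Integrable (zetaIntegrand s) (divMeasure F) := by
  have h : zetaIntegrand (F := F) s = fun D ↦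
      (effectivity D : ℂ) * Complex.exp (-s * degree D) := funext fun D ↦ by
    rw [zetaIntegrand, norm_cpow]
  rw [h]
  refine ⟨(measurable_effectivity.complex_ofReal.mul
    (measurable_degree.complex_ofReal.const_mul _).cexp).aestronglyMeasurable, ?_⟩
  refine lt_of_eq_of_lt (lintegral_congr fun D ↦ ?_) (lintegral_effectivity_exp_lt_top hs)
  rw [enorm_mul, ← ofReal_norm, ← ofReal_norm, Complex.norm_real,
    Real.norm_of_nonneg (effectivity_nonneg D), Complex.norm_exp]
  simp

variable (F) in
/-- No condition on `s` is needed: where the integrals diverge, both sides are the junk value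
`0`. -/
lemma integral_exp_eq_zeta (s : ℂ) :
    ∫ c, ((Real.exp (picH0 c) - 1 : ℝ) : ℂ) * Complex.exp (s * defect c) ∂picMeasure F =
      Units.torsionOrder F * ((√|(discr F : ℝ)| : ℝ) : ℂ) ^ s * zeta F s := by
  rw [integral_effectivity_mul (measurable_defect.complex_ofReal.const_mul s).cexp, mul_assoc, zeta,
    ← integral_const_mul (((√|(discr F : ℝ)| : ℝ) : ℂ) ^ s)]
  congr 1
  refine integral_congr_ae (.of_forall fun D ↦ ?_)
  simp only [cexp_mul_defect_mk, zetaIntegrand]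
  ring

lemma isMeromorphic_sub_poles {H : ℂ × ℂ → ℂ} (hH : ∀ p, AnalyticAt ℂ H p) (V : ℂ) :
    IsMeromorphic fun q : ℂ × ℂ ↦ H q - V / q.1 - V / q.2 := by
  refine fun p ↦ ⟨fun q ↦ H q * (q.1 * q.2) - V * q.2 - V * q.1, fun q ↦ q.1 * q.2, ?_,
    analyticAt_fst.mul analyticAt_snd, ?_, .of_forall fun q hq ↦ ?_⟩
  · exact (((hH p).mul (analyticAt_fst.mul analyticAt_snd)).sub
      (analyticAt_const.mul analyticAt_snd)).sub (analyticAt_const.mul analyticAt_fst)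
  · refine (mem_closure_iff_frequently.mp
      (((dense_compl_singleton (0 : ℂ)).prod (dense_compl_singleton (0 : ℂ))) p)).mono ?_
    exact fun q hq ↦ mul_ne_zero hq.1 hq.2
  · have h1 := left_ne_zero_of_mul hq
    have h2 := right_ne_zero_of_mul hq
    field_simp

lemma analyticAt_sub_poles {H : ℂ × ℂ → ℂ} (hH : ∀ p, AnalyticAt ℂ H p) (V : ℂ) {p : ℂ × ℂ}
    (h1 : p.1 ≠ 0) (h2 : p.2 ≠ 0) : AnalyticAt ℂ (fun q : ℂ × ℂ ↦ H q - V / q.1 - V / q.2) p :=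
  ((hH p).sub (analyticAt_const.div analyticAt_fst h1)).sub
    (analyticAt_const.div analyticAt_snd h2)

/-- A function that is entire up to simple poles at `0` and `1` is meromorphic. -/
lemma isMeromorphic_of_mul_analytic {Z G : ℂ → ℂ} (hG : ∀ s, AnalyticAt ℂ G s)
    (hZ : ∀ s, s ≠ 0 → s ≠ 1 → Z s * (s * (1 - s)) = G s) : IsMeromorphic Z := by
  refine fun p ↦ ⟨G, fun s ↦ s * (1 - s), hG p,
    analyticAt_id.mul (analyticAt_const.sub analyticAt_id), ?_, .of_forall fun s hs ↦ ?_⟩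
  · have hd : Dense ({0, 1} : Set ℂ)ᶜ := (Set.toFinite _).countable.dense_compl ℂ
    refine (mem_closure_iff_frequently.mp (hd p)).mono fun s hs ↦ ?_
    simp only [Set.mem_compl_iff, Set.mem_insert_iff, Set.mem_singleton_iff, not_or] at hs
    exact mul_ne_zero hs.1 (sub_ne_zero.mpr (Ne.symm hs.2))
  · have h1 := left_ne_zero_of_mul hs
    have h2 := right_ne_zero_of_mul hs
    rw [eq_div_iff hs]
    exact hZ s h1 fun h ↦ h2 (by rw [h, sub_self])

end Continuation
end Arakelov

theorem proposition6 (F : Type*) [Field F] [NumberField F] :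
    (∀ s t : ℂ, s.re < 0 → t.re < 0 →
      Integrable (Arakelov.twoVarIntegrand s t) (Arakelov.picMeasure F)) ∧
    ∃ Φ : ℂ × ℂ → ℂ, Arakelov.IsMeromorphic Φ ∧
      (∀ s t : ℂ, s.re < 0 → t.re < 0 → Φ (s, t) = Arakelov.twoVarZeta F s t) ∧
      ∃ Z : ℂ → ℂ, Arakelov.IsMeromorphic Z ∧
        (∀ s : ℂ, 1 < s.re →
          Integrable (Arakelov.zetaIntegrand s) (Arakelov.divMeasure F) ∧
            Z s = Arakelov.zeta F s) ∧
        ∀ s : ℂ, s ≠ 0 → s ≠ 1 → AnalyticAt ℂ Z s ∧ AnalyticAt ℂ Φ (s, 1 - s) ∧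
          Φ (s, 1 - s) =
            (Units.torsionOrder F : ℂ) * ((√|(discr F : ℝ)| : ℝ) : ℂ) ^ s * Z s := by
  obtain ⟨V, hV⟩ := Arakelov.exists_map_defect_eq F
  obtain ⟨A, hA⟩ := Arakelov.exists_picH0_le F
  obtain ⟨hint, H, hH, hHint, hHzeta⟩ := Arakelov.exists_twoVariable_continuation
    Arakelov.measurable_picH0 Arakelov.measurable_defect Arakelov.picH0_nonneg
    Arakelov.measurePreserving_reflect Arakelov.picH0_reflect Arakelov.defect_reflect hV ⟨A, hA⟩
    fun c hc ↦ Arakelov.integrable_pic hc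
  have heq (s t : ℂ) : Arakelov.twoVarIntegrand (F := F) s t = fun c ↦ Complex.exp
      (s * Arakelov.picH0 c + t * (Arakelov.picH0 c + Arakelov.defect c : ℝ)) := by
    ext c
    rw [Arakelov.twoVarIntegrand, Arakelov.defect, add_sub_cancel]
  set W : ℂ → ℂ := fun s ↦
    (Units.torsionOrder F : ℂ) * ((√|(discr F : ℝ)| : ℝ) : ℂ) ^ s with hW
  have hD : ((√|(discr F : ℝ)| : ℝ) : ℂ) ≠ 0 := by
    exact_mod_cast (Arakelov.sqrt_discr_pos F).ne'
  have hW0 (s : ℂ) : W s ≠ 0 := mul_ne_zero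
    (Nat.cast_ne_zero.mpr (Units.torsionOrder_ne_zero F)) ((Complex.cpow_ne_zero_iff).mpr (.inl hD))
  have hWa (s : ℂ) : AnalyticAt ℂ W s := by
    have : W = fun s ↦ (Units.torsionOrder F : ℂ) *
        Complex.exp (Complex.log ((√|(discr F : ℝ)| : ℝ) : ℂ) * s) := by
      ext s
      rw [hW, ← Complex.cpow_def_of_ne_zero hD]
    rw [this]
    fun_prop
  have hline (s : ℂ) : AnalyticAt ℂ (fun s : ℂ ↦ (s, 1 - s)) s :=
    analyticAt_id.prod (analyticAt_const.sub analyticAt_id)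
  refine ⟨fun s t hs ht ↦ by rw [heq]; exact hint s t hs ht,
    fun q ↦ H q - V / q.1 - V / q.2, Arakelov.isMeromorphic_sub_poles hH V, fun s t hs ht ↦ ?_,
    fun s ↦ (H (s, 1 - s) - V / s - V / (1 - s)) / W s, ?_, fun s hs ↦ ?_, fun s h0 h1 ↦ ?_⟩
  · rw [Arakelov.twoVarZeta, heq]
    exact (hHint s t hs ht).symm
  · refine Arakelov.isMeromorphic_of_mul_analytic
      (G := fun s ↦ (H (s, 1 - s) * (s * (1 - s)) - V * (1 - s) - V * s) / W s)
      (fun s ↦ ?_) fun s h0 h1 ↦ ?_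
    · have := (hH (s, 1 - s)).comp_of_eq (hline s) rfl
      refine AnalyticAt.div ?_ (hWa s) (hW0 s)
      exact ((this.mul (analyticAt_id.mul (analyticAt_const.sub analyticAt_id))).sub
        (analyticAt_const.mul (analyticAt_const.sub analyticAt_id))).sub
          (analyticAt_const.mul analyticAt_id)
    · have h1' : 1 - s ≠ 0 := sub_ne_zero.mpr (Ne.symm h1)
      have := hW0 s
      field_simp
  · refine ⟨Arakelov.integrable_zetaIntegrand hs, ?_⟩
    rw [div_eq_iff (hW0 s), ← hHzeta s hs, Arakelov.integral_exp_eq_zeta]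
    exact mul_comm _ _
  · have h1' : 1 - s ≠ 0 := sub_ne_zero.mpr (Ne.symm h1)
    have hΦ := Arakelov.analyticAt_sub_poles hH V (p := (s, 1 - s)) h0 h1'
    exact ⟨(hΦ.comp_of_eq (hline s) rfl).div (hWa s) (hW0 s), hΦ, (mul_div_cancel₀ _ (hW0 s)).symm⟩
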